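/- Let $A$ be a commutative ring, $G$ a group, $H\le G$ a subgroup with inclusion $\iota\colon H\hookrightarrow G$. For a group $K$ let $\mathsf{B}K$ be the category with one object whose endomorphism monoid is $K$, so that functors $\mathsf{B}K\to A\text{-}\mathsf{Mod}$ are the $A$-linear representations of $K$; let $\mathbf{D}(\mathsf{B}K)$ be the unbounded derived category of the abelian category $A\text{-}\mathsf{Mod}^{\mathsf{B}K}$, and $\mathbf{D}(A)$ that of $A\text{-}\mathsf{Mod}$. Let $\mathsf{B}\iota_!$ and $\mathsf{B}\iota_*$ be the left and right Kan extension functors along $\mathsf{B}\iota\colon\mathsf{B}H\to\mathsf{B}G$, applied degreewise to complexes. (1) The total left derived functors $\mathbf{L}\varinjlim_{\mathsf{B}G}\colon\mathbf{D}(\mathsf{B}G)\to\mathbf{D}(A)$, $\mathbf{L}\varinjlim_{\mathsf{B}H}\colon\mathbf{D}(\mathsf{B}H)\to\mathbf{D}(A)$ and $\mathbf{L}\mathsf{B}\iota_!\colon\mathbf{D}(\mathsf{B}H)\to\mathbf{D}(\mathsf{B}G)$ exist, the canonical morphism $\mathbf{L}\mathsf{B}\iota_!\widetilde M\to\mathsf{B}\iota_!\widetilde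 M$ is an isomorphism for every complex $\widetilde M$ of representations of $H$ (so one writes $\mathsf{B}\iota_!$ for $\mathbf{L}\mathsf{B}\iota_!$), and there is an isomorphism, natural in $\widetilde M\in\mathbf{D}(\mathsf{B}H)$, $$\mathbf{L}\varinjlim_{\mathsf{B}G}\mathsf{B}\iota_!\widetilde M\;\cong\;\mathbf{L}\varinjlim_{\mathsf{B}H}\widetilde M ,$$ compatible, through the canonical morphisms from derived to underived functors, with the underived isomorphism $\varinjlim_{\mathsf{B}G}\mathsf{B}\iota_!\widetilde M\cong\varinjlim_{\mathsf{B}H}\widetilde M$ of complexes. (2) Dually, the total right derived functors $\mathbf{R}\varprojlim_{\mathsf{B}G}$, $\mathbf{R}\varprojlim_{\mathsf{B}H}$ and $\mathbf{R}\mathsf{B}\iota_*$ exist, the canonical morphism $\mathsf{B}\iota_*\widetilde M\to\mathbf{R}\mathsf{B}\iota_*\widetilde M$ is an isomorphism for every complex $\widetilde M$ of representations of $H$, and there is an isomorphism, natural in $\widetilde M\in\mathbf{D}(\mathsf{B}H)$, $$\mathbf{R}\varprojlim_{\mathsf{B}G}\mathsf{B}\iota_*\widetilde M\;\cong\;\mathbf{R}\varprojlim_{\mathsf{B}H}\widetilde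 M ,$$ compatible with the underived isomorphism $\varprojlim_{\mathsf{B}G}\mathsf{B}\iota_*\widetilde M\cong\varprojlim_{\mathsf{B}H}\widetilde M$. (3) For every $n\in\mathbb{Z}$ there are isomorphisms, natural in the $A$-linear representation $M$ of $H$, $$\mathrm{H}_n(G,\mathrm{Ind}^G_H M)\cong \mathrm{H}_n(H,M),\qquad \mathrm{H}^n(G,\mathrm{CoInd}^G_H M)\cong \mathrm{H}^n(H,M),$$ where group homology and cohomology vanish for $n<0$. For $n\ge 0$ these are the canonical ones: the inverse of the first is induced by $\iota$ and the unit $M\to \mathrm{Ind}^G_H M$ of the adjunction between induction and restriction, and the second is induced by $\iota$ and the counit $\mathrm{CoInd}^G_H M\to M$ of the adjunction between restriction and coinduction. -/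

import Mathlib

open CategoryTheory CategoryTheory.Limits

universe w v₁ v₂ u₁ u₂ u

namespace DerivedShapiro

noncomputable section

/-! ### Total derived functors on unbounded derived categories -/

section Derived

variable {C : Type u₁} {D : Type u₂} [Category.{v₁} C] [Category.{v₂} D] [Abelian C] [Abelian D]
  [HasDerivedCategory.{w} C] [HasDerivedCategory.{w} D]

/-- The functor `𝐂(C) ⥤ 𝐃(D)` which applies the additive functor `F` degreewise to an unbounded
complex and regards the result as an object of the derived category. -/
abbrev toDerived (F : C ⥤ D) [F.Additive] : CochainComplex C ℤ ⥤ DerivedCategory D :=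
  F.mapHomologicalComplex (ComplexShape.up ℤ) ⋙ DerivedCategory.Q

/-- `F` has a total left derived functor `𝐃(C) ⥤ 𝐃(D)`. -/
abbrev HasL (F : C ⥤ D) [F.Additive] : Prop :=
  (toDerived F).HasLeftDerivedFunctor (HomologicalComplex.quasiIso C (ComplexShape.up ℤ))

/-- `F` has a total right derived functor `𝐃(C) ⥤ 𝐃(D)`. -/
abbrev HasR (F : C ⥤ D) [F.Additive] : Prop :=
  (toDerived F).HasRightDerivedFunctor (HomologicalComplex.quasiIso C (ComplexShape.up ℤ))

/-- The total left derived functor `𝐋F : 𝐃(C) ⥤ 𝐃(D)`. -/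
abbrev L (F : C ⥤ D) [F.Additive] [HasL F] : DerivedCategory C ⥤ DerivedCategory D :=
  (toDerived F).totalLeftDerived DerivedCategory.Q
    (HomologicalComplex.quasiIso C (ComplexShape.up ℤ))

/-- The canonical morphisms `𝐋F(K) ⟶ F(K)`, for complexes `K`. -/
abbrev LCounit (F : C ⥤ D) [F.Additive] [HasL F] : DerivedCategory.Q ⋙ L F ⟶ toDerived F :=
  (toDerived F).totalLeftDerivedCounit DerivedCategory.Q
    (HomologicalComplex.quasiIso C (ComplexShape.up ℤ))

/-- The total right derived functor `𝐑F : 𝐃(C) ⥤ 𝐃(D)`. -/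
abbrev R (F : C ⥤ D) [F.Additive] [HasR F] : DerivedCategory C ⥤ DerivedCategory D :=
  (toDerived F).totalRightDerived DerivedCategory.Q
    (HomologicalComplex.quasiIso C (ComplexShape.up ℤ))

/-- The canonical morphisms `F(K) ⟶ 𝐑F(K)`, for complexes `K`. -/
abbrev RUnit (F : C ⥤ D) [F.Additive] [HasR F] : toDerived F ⟶ DerivedCategory.Q ⋙ R F :=
  (toDerived F).totalRightDerivedUnit DerivedCategory.Q
    (HomologicalComplex.quasiIso C (ComplexShape.up ℤ))

end Derived

/-! ### Representations as diagrams on the classifying category of a group -/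

/-- The category of `A`-linear representations of `G`, as functors `BG ⥤ A-Mod` on the one-object
category `BG` with endomorphism monoid `G`. -/
abbrev RepCat (A G : Type u) [CommRing A] [Group G] : Type (u + 1) :=
  SingleObj G ⥤ ModuleCat.{u} A

section Kan

variable (A : Type u) [CommRing A] {G : Type u} [Group G]

instance hasLimitsOfShape_B (G : Type u) [Group G] :
    HasLimitsOfShape (SingleObj G) (ModuleCat.{u} A) :=
  ModuleCat.hasLimitsOfShape

/-- The colimit functor over `BG`: the coinvariants. -/
abbrev colimB (G : Type u) [Group G] : RepCat A G ⥤ ModuleCat.{u} A := colim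

/-- The limit functor over `BG`: the invariants. -/
abbrev limB (G : Type u) [Group G] : RepCat A G ⥤ ModuleCat.{u} A := lim

/-- The functor `Bι : BH ⥤ BG` given by the inclusion of a subgroup. -/
abbrev Bι (H : Subgroup G) : SingleObj H ⥤ SingleObj G := H.subtype.toFunctor

/-- The left Kan extension functor `Bι_!`. -/
abbrev shriek (H : Subgroup G) : RepCat A H ⥤ RepCat A G := (Bι H).lan

/-- The right Kan extension functor `Bι_*`. -/
abbrev star (H : Subgroup G) : RepCat A H ⥤ RepCat A G := (Bι H).ran

instance constB_additive (G : Type u) [Group G] :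
    (Functor.const (SingleObj G) : ModuleCat.{u} A ⥤ RepCat A G).Additive where
  map_add := rfl

instance colimB_additive (G : Type u) [Group G] : (colimB A G).Additive :=
  Adjunction.left_adjoint_additive (colimConstAdj (J := SingleObj G) (C := ModuleCat.{u} A))

instance limB_additive (G : Type u) [Group G] : (limB A G).Additive :=
  Adjunction.right_adjoint_additive (constLimAdj (J := SingleObj G) (C := ModuleCat.{u} A))

instance shriek_additive (H : Subgroup G) : (shriek A H).Additive :=
  ((Bι H).lanAdjunction (ModuleCat.{u} A)).left_adjoint_additive

instance star_additive (H : Subgroup G) : (star A H).Additive :=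
  ((Bι H).ranAdjunction (ModuleCat.{u} A)).right_adjoint_additive

/-- The underived isomorphism `colim_{BG} Bι_! K ⟶ colim_{BH} K`, for a complex `K`. -/
def colimComparison (H : Subgroup G) (K : CochainComplex (RepCat A H) ℤ) :
    ((colimB A G).mapHomologicalComplex (ComplexShape.up ℤ)).obj
        (((shriek A H).mapHomologicalComplex (ComplexShape.up ℤ)).obj K) ⟶
      ((colimB A H).mapHomologicalComplex (ComplexShape.up ℤ)).obj K :=
  (NatTrans.mapHomologicalComplex
    ((Bι H).lanCompColimIso (H := ModuleCat.{u} A)).hom (ComplexShape.up ℤ)).app K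

/-- The underived isomorphism `lim_{BG} Bι_* K ⟶ lim_{BH} K`, for a complex `K`. -/
def limComparison (H : Subgroup G) (K : CochainComplex (RepCat A H) ℤ) :
    ((limB A G).mapHomologicalComplex (ComplexShape.up ℤ)).obj
        (((star A H).mapHomologicalComplex (ComplexShape.up ℤ)).obj K) ⟶
      ((limB A H).mapHomologicalComplex (ComplexShape.up ℤ)).obj K :=
  (NatTrans.mapHomologicalComplex
    ((Bι H).ranCompLimIso (H := ModuleCat.{u} A)).hom (ComplexShape.up ℤ)).app K

end Kan

/-! ### Group homology and cohomology in all integral degrees -/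

/-- The functor `M ↦ H_n(G, M)` for `n : ℤ`; it is zero for `n < 0`. -/
def groupHomologyInt (A G : Type u) [CommRing A] [Group G] : ℤ → (Rep.{u} A G ⥤ ModuleCat.{u} A)
  | Int.ofNat n => groupHomology.functor A G n
  | Int.negSucc _ => (Functor.const _).obj (ModuleCat.of A PUnit)

/-- The functor `M ↦ H^n(G, M)` for `n : ℤ`; it is zero for `n < 0`. -/
def groupCohomologyInt (A G : Type u) [CommRing A] [Group G] : ℤ → (Rep.{u} A G ⥤ ModuleCat.{u} A)
  | Int.ofNat n => groupCohomology.functor A G n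
  | Int.negSucc _ => (Functor.const _).obj (ModuleCat.of A PUnit)

end

end DerivedShapiro

-- Underived, `colim_{BG} ∘ Bι_! ≅ colim_{BH}` holds because both sides are left adjoint to the
-- constant diagram functor. Deriving a composite requires that the first functor preserve complexes
-- adapted to the second, and on unbounded complexes the adapted ones are the K-projectives.
-- Restriction along `Bι` is exact, so its left adjoint `Bι_!` preserves K-projectives; dually
-- `Bι_*` preserves K-injectives. The universal comparison `𝐋colim_{BG} ∘ 𝐋Bι_! ⟶ 𝐋colim_{BH}` is
-- then invertible on K-projectives, hence everywhere (`exists_leftDerived_comp_iso`,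
-- `exists_rightDerived_comp_iso`).
--
-- Two inputs remain. Enough K-injectives: a complex is the limit of its truncations `τ_{≥ -n}`, and
-- the homotopy limit of their injective resolutions is a K-injective resolution
-- (`exists_kInjective_resolution`); K-projectives follow by passing to the opposite category.
-- Exactness of `Bι_!` and `Bι_*`: the comma categories of `Bι` are thin groupoids, since `H` acts
-- freely on `G` by translation, so the Kan extensions are pointwise direct sums and products of
-- modules.
--
-- The statement in integral degrees is proved separately on bar resolutions. The inclusion of the
-- bar resolution of `H` into that of `G` is an `H`-homotopy equivalence, and `M ⊗_H Res P ≅ Ind M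
-- ⊗_G P` and `Hom_G(P, CoInd M) ≅ Hom_H(Res P, M)` turn it into the canonical maps on homology and
-- cohomology.

universe v₃ u₃

namespace DerivedShapiro

noncomputable section

/-! ### Products of complexes, computed degreewise. -/

section Products

variable {C : Type u₁} [Category.{v₁} C] [Abelian C] {ι : Type w} [HasProductsOfShape ι C]

instance lim_discrete_additive : (lim : (Discrete ι ⥤ C) ⥤ C).Additive :=
  have : (Functor.const (Discrete ι) : C ⥤ Discrete ι ⥤ C).Additive := ⟨rfl⟩
  constLimAdj.right_adjoint_additive

/-- A family of complexes, as a complex of families. -/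
@[simps]
def familyComplex (T : ι → CochainComplex C ℤ) : CochainComplex (Discrete ι ⥤ C) ℤ where
  X i := Discrete.functor fun n => (T n).X i
  d i j := Discrete.natTrans fun n => (T n.as).d i j
  shape i j h := by
    ext n
    exact (T n.as).shape i j h
  d_comp_d' i j k _ _ := by
    ext n
    exact (T n.as).d_comp_d i j k

/-- The map of complexes of families given by a family of maps of complexes. -/
@[simps]
def familyMap {T T' : ι → CochainComplex C ℤ} (φ : ∀ n, T n ⟶ T' n) :
    familyComplex T ⟶ familyComplex T' where
  f i := Discrete.natTrans fun n => (φ n.as).f i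
  comm' i j _ := by
    ext n
    exact (φ n.as).comm i j

/-- Evaluation at an index commutes with homology, and isomorphisms of families are detected at each
index. -/
instance quasiIso_familyMap {T T' : ι → CochainComplex C ℤ} (φ : ∀ n, T n ⟶ T' n)
    [∀ n, QuasiIso (φ n)] : QuasiIso (familyMap φ) := by
  rw [quasiIso_iff]
  intro i
  rw [quasiIsoAt_iff]
  rw [ShortComplex.quasiIso_iff]
  rw [NatTrans.isIso_iff_isIso_app]
  intro n
  have := (quasiIsoAt_iff (φ n.as) i).1 inferInstance
  rw [ShortComplex.quasiIso_iff] at this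
  exact (NatIso.isIso_map_iff (ShortComplex.homologyFunctorIso ((evaluation (Discrete ι) C).obj n))
    ((HomologicalComplex.shortComplexFunctor _ _ i).map (familyMap φ))).1 this

/-- The product of a family of complexes. -/
def prodComplex (T : ι → CochainComplex C ℤ) : CochainComplex C ℤ :=
  ((lim : (Discrete ι ⥤ C) ⥤ C).mapHomologicalComplex _).obj (familyComplex T)

/-- The map of products given by a family of maps. -/
def prodMap {T T' : ι → CochainComplex C ℤ} (φ : ∀ n, T n ⟶ T' n) :
    prodComplex T ⟶ prodComplex T' :=
  ((lim : (Discrete ι ⥤ C) ⥤ C).mapHomologicalComplex _).map (familyMap φ)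

/-- This is where exactness of products enters: the product functor is then exact and preserves
homology. -/
instance quasiIso_prodMap [HasExactLimitsOfShape (Discrete ι) C]
    {T T' : ι → CochainComplex C ℤ} (φ : ∀ n, T n ⟶ T' n)
    [∀ n, QuasiIso (φ n)] : QuasiIso (prodMap φ) := by
  have : PreservesFiniteLimits (lim : (Discrete ι ⥤ C) ⥤ C) :=
    (Adjunction.rightAdjoint_preservesLimits.{0, 0} constLimAdj).preservesFiniteLimits
  exact HomologicalComplex.quasiIso_map_of_preservesHomology (familyMap φ) lim

/-- The projections from the product. -/
def prodπ (T : ι → CochainComplex C ℤ) (n : ι) : prodComplex T ⟶ T n where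
  f i := limit.π (Discrete.functor fun n => (T n).X i) ⟨n⟩
  comm' i j _ := (limMap_π ((familyComplex T).d i j) ⟨n⟩).symm

/-- The degreewise projections exhibit the terms of the product as products. -/
def isLimitProdπ (T : ι → CochainComplex C ℤ) (i : ℤ) :
    IsLimit (Fan.mk ((prodComplex T).X i) fun n => (prodπ T n).f i) :=
  (limit.isLimit _).ofIsoLimit (Cone.ext (Iso.refl _) (by rintro ⟨n⟩; exact (Category.id_comp _).symm))

lemma prodComplex_X_hom_ext {T : ι → CochainComplex C ℤ} {i : ℤ} {Y : C}
    {f g : Y ⟶ (prodComplex T).X i} (h : ∀ n, f ≫ (prodπ T n).f i = g ≫ (prodπ T n).f i) :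
    f = g :=
  Fan.IsLimit.hom_ext (isLimitProdπ T i) _ _ h

/-- The lift in degree `i` to a product of complexes. -/
def prodLiftX {T : ι → CochainComplex C ℤ} {i : ℤ} {Y : C} (f : ∀ n, Y ⟶ (T n).X i) :
    Y ⟶ (prodComplex T).X i :=
  Fan.IsLimit.lift (isLimitProdπ T i) f

@[simp]
lemma prodLiftX_π {T : ι → CochainComplex C ℤ} {i : ℤ} {Y : C} (f : ∀ n, Y ⟶ (T n).X i) (n : ι) :
    prodLiftX f ≫ (prodπ T n).f i = f n :=
  Fan.IsLimit.fac (isLimitProdπ T i) f n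

@[simp]
lemma prodLiftX_π_assoc {T : ι → CochainComplex C ℤ} {i : ℤ} {Y Z : C} (f : ∀ n, Y ⟶ (T n).X i)
    (n : ι) (g : (T n).X i ⟶ Z) : prodLiftX f ≫ (prodπ T n).f i ≫ g = f n ≫ g := by
  rw [← Category.assoc, prodLiftX_π]

/-- The map of complexes to a product given by a family of maps. -/
def prodLift {T : ι → CochainComplex C ℤ} {K : CochainComplex C ℤ} (f : ∀ n, K ⟶ T n) :
    K ⟶ prodComplex T where
  f i := prodLiftX fun n => (f n).f i
  comm' i j _ := prodComplex_X_hom_ext fun n => by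
    rw [Category.assoc, ← (prodπ T n).comm]
    rw [prodLiftX_π_assoc]
    simp

@[simp]
lemma prodLift_π {T : ι → CochainComplex C ℤ} {K : CochainComplex C ℤ} (f : ∀ n, K ⟶ T n) (n : ι) :
    prodLift f ≫ prodπ T n = f n := by
  ext i
  simp [prodLift]

lemma prodComplex_hom_ext {T : ι → CochainComplex C ℤ} {K : CochainComplex C ℤ}
    {f g : K ⟶ prodComplex T} (h : ∀ n, f ≫ prodπ T n = g ≫ prodπ T n) : f = g := by
  ext i
  exact prodComplex_X_hom_ext fun n => by simpa using HomologicalComplex.congr_hom (h n) i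

@[simp]
lemma prodMap_π {T T' : ι → CochainComplex C ℤ} (φ : ∀ n, T n ⟶ T' n) (n : ι) :
    prodMap φ ≫ prodπ T' n = prodπ T n ≫ φ n := by
  ext i
  exact limMap_π ((familyMap φ).f i) ⟨n⟩

/-- Homotopies into a product are given componentwise. -/
def prodHomotopy {T : ι → CochainComplex C ℤ} {K : CochainComplex C ℤ} {f g : K ⟶ prodComplex T}
    (h : ∀ n, Homotopy (f ≫ prodπ T n) (g ≫ prodπ T n)) : Homotopy f g where
  hom i j := prodLiftX fun n => (h n).hom i j
  zero i j hij := prodComplex_X_hom_ext fun n => by simp [(h n).zero i j hij]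
  comm i := prodComplex_X_hom_ext fun n => by
    have := (h n).comm i
    simp only [dNext, prevD, AddMonoidHom.mk'_apply, Preadditive.add_comp, Category.assoc,
      HomologicalComplex.comp_f, prodLiftX_π] at this ⊢
    rw [← (prodπ T n).comm, prodLiftX_π_assoc]
    exact this

/-- Null-homotopies of the components assemble into one of the map to the product; exactness of
products plays no role. -/
instance isKInjective_prodComplex (T : ι → CochainComplex C ℤ) [∀ n, (T n).IsKInjective] :
    (prodComplex T).IsKInjective where
  nonempty_homotopy_zero f hK :=
    ⟨prodHomotopy fun n =>
      (CochainComplex.IsKInjective.homotopyZero (f ≫ prodπ T n) hK).trans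
        (Homotopy.ofEq (by simp))⟩

end Products

/-! ### K-injective resolutions of unbounded complexes as homotopy limits of truncations. -/

section Towers

variable {C : Type u₁} [Category.{v₁} C] [Abelian C]

/-- In a tower `⋯ ⟶ X 1 ⟶ X 0` which is eventually constant, the equations
`x n - x (n + 1) = y n` can be solved. -/
lemma exists_tower_solution {X : ℕ → C} (f : ∀ n, X (n + 1) ⟶ X n) (N : ℕ)
    (hf : ∀ n, N ≤ n → IsIso (f n)) {Z : C} (y : ∀ n, Z ⟶ X n) :
    ∃ x : ∀ n, Z ⟶ X n, ∀ n, x n - x (n + 1) ≫ f n = y n := by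
  suffices ∀ m, m ≤ N → ∃ x : ∀ n, Z ⟶ X n, ∀ n, m ≤ n → x n - x (n + 1) ≫ f n = y n by
    obtain ⟨x, hx⟩ := this 0 (Nat.zero_le _)
    exact ⟨x, fun n => hx n (Nat.zero_le _)⟩
  intro m hm
  induction hm using Nat.decreasingInduction with
  | self =>
    -- From `N` on, `x (n + 1)` is solved from `x n` by inverting `f n`; the recursion starts with 0
    -- at index 0, and its values below `N` are discarded later.
    have (n : ℕ) (x : Z ⟶ X n) : ∃ x' : Z ⟶ X (n + 1), N ≤ n → x - x' ≫ f n = y n := by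
      by_cases hn : N ≤ n
      · have := hf n hn
        exact ⟨(x - y n) ≫ inv (f n), fun _ => by simp⟩
      · exact ⟨0, fun h => (hn h).elim⟩
    choose s hs using this
    let x (n : ℕ) : Z ⟶ X n := Nat.rec 0 s n
    exact ⟨x, fun n hn => hs n (x n) hn⟩
  | of_succ m hm ih =>
    obtain ⟨x, hx⟩ := ih
    -- Below `N` no inversion is needed: `x m` is read off from `x (m + 1)`.
    refine ⟨Function.update x m (y m + x (m + 1) ≫ f m), fun n hn => ?_⟩
    rw [Function.update_of_ne (by omega : n + 1 ≠ m)]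
    obtain rfl | hn := hn.eq_or_lt
    · simp
    · rw [Function.update_of_ne hn.ne']
      exact hx n hn

/-- The Milnor short exact sequence of an eventually constant tower. -/
lemma shortExact_of_tower {X : ℕ → C} (f : ∀ n, X (n + 1) ⟶ X n) {Y : C} (a : ∀ n, Y ⟶ X n)
    (ha : ∀ n, a (n + 1) ≫ f n = a n) (N : ℕ) (hN : ∀ n, N ≤ n → IsIso (a n))
    {P : C} (π : ∀ n, P ⟶ X n) (hP : IsLimit (Fan.mk P π)) (i : Y ⟶ P) (hi : ∀ n, i ≫ π n = a n)
    (s : P ⟶ P) (hs : ∀ n, s ≫ π n = π n - π (n + 1) ≫ f n) (w : i ≫ s = 0) :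
    (ShortComplex.mk i s w).ShortExact := by
  have hf (n : ℕ) (hn : N ≤ n) : IsIso (f n) := by
    have := hN n hn
    have := hN (n + 1) (by omega)
    have h := ha n
    rw [← IsIso.eq_inv_comp] at h
    rw [h]
    infer_instance
  have := hN N le_rfl
  have hmono : Mono i := mono_of_mono_fac (hi N)
  obtain ⟨x, hx⟩ := exists_tower_solution f N hf π
  have hepi : Epi s := by
    -- Solving the tower equations with right-hand side `π` gives a section of `s`, so surjectivity
    -- does not depend on exactness of products.
    have : Fan.IsLimit.lift hP x ≫ s = 𝟙 P := by
      refine Fan.IsLimit.hom_ext hP _ _ fun n => ?_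
      have := Fan.IsLimit.fac hP x
      dsimp [Fan.proj] at this ⊢
      rw [Category.assoc, hs, Preadditive.comp_sub, this, ← Category.assoc, this, hx,
        Category.id_comp]
    exact epi_of_epi_fac this
  refine { exact := ShortComplex.exact_of_f_is_kernel _ (KernelFork.IsLimit.ofι' _ _ fun k hk => ?_) }
  dsimp at hk
  have hk' (n : ℕ) : k ≫ π n = (k ≫ π (n + 1)) ≫ f n := by
    have : k ≫ s ≫ π n = 0 := by rw [← Category.assoc, hk, zero_comp]
    rw [hs, Preadditive.comp_sub, sub_eq_zero] at this
    rw [this, Category.assoc]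
  -- A map killed by `s` is a compatible family, determined by its component at the single index `N`
  -- where `a N` is invertible.
  refine ⟨k ≫ π N ≫ inv (a N), ?_⟩
  let l := k ≫ π N ≫ inv (a N)
  have hl (n : ℕ) : l ≫ a n = k ≫ π n := by
    rcases le_total N n with hn | hn
    · induction n, hn using Nat.le_induction with
      | base => simp [l]
      | succ n hn ih =>
        have := hf n hn
        rw [← cancel_mono (f n), Category.assoc, ha, ih, hk']
    · induction hn using Nat.decreasingInduction with
      | self => simp [l]
      | of_succ n hn ih => rw [← ha, ← Category.assoc, ih, ← hk']
  refine Fan.IsLimit.hom_ext hP _ _ fun n => ?_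
  change (l ≫ i) ≫ π n = k ≫ π n
  rw [Category.assoc, hi, hl]

section Complexes

variable [HasProductsOfShape ℕ C]

/-- The difference between the identity and the shift on the product of a tower of complexes. -/
def oneSubShift {T : ℕ → CochainComplex C ℤ} (p : ∀ n, T (n + 1) ⟶ T n) :
    prodComplex T ⟶ prodComplex T :=
  prodLift fun n => prodπ T n - prodπ T (n + 1) ≫ p n

@[simp]
lemma oneSubShift_π {T : ℕ → CochainComplex C ℤ} (p : ∀ n, T (n + 1) ⟶ T n) (n : ℕ) :
    oneSubShift p ≫ prodπ T n = prodπ T n - prodπ T (n + 1) ≫ p n :=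
  prodLift_π _ _

lemma oneSubShift_π_assoc {T : ℕ → CochainComplex C ℤ} (p : ∀ n, T (n + 1) ⟶ T n) (n : ℕ)
    {K : CochainComplex C ℤ} (g : T n ⟶ K) :
    oneSubShift p ≫ prodπ T n ≫ g = prodπ T n ≫ g - prodπ T (n + 1) ≫ p n ≫ g := by
  rw [← Category.assoc, oneSubShift_π, Preadditive.sub_comp, Category.assoc]

lemma prodLift_oneSubShift {T : ℕ → CochainComplex C ℤ} (p : ∀ n, T (n + 1) ⟶ T n)
    {K : CochainComplex C ℤ} (t : ∀ n, K ⟶ T n) (ht : ∀ n, t (n + 1) ≫ p n = t n) :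
    prodLift t ≫ oneSubShift p = 0 :=
  prodComplex_hom_ext fun n => by
    rw [Category.assoc, oneSubShift_π, Preadditive.comp_sub, prodLift_π, ← Category.assoc,
      prodLift_π, ht, sub_self, zero_comp]

lemma shortExact_prodLift_oneSubShift {T : ℕ → CochainComplex C ℤ} (p : ∀ n, T (n + 1) ⟶ T n)
    {K : CochainComplex C ℤ} (t : ∀ n, K ⟶ T n) (ht : ∀ n, t (n + 1) ≫ p n = t n)
    (h : ∀ i : ℤ, ∃ N : ℕ, ∀ n, N ≤ n → IsIso ((t n).f i)) :
    (ShortComplex.mk _ _ (prodLift_oneSubShift p t ht)).ShortExact := by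
  refine HomologicalComplex.shortExact_of_degreewise_shortExact _ fun i => ?_
  obtain ⟨N, hN⟩ := h i
  exact shortExact_of_tower (fun n => (p n).f i) (fun n => (t n).f i)
    (fun n => by rw [← HomologicalComplex.comp_f, ht]) N hN _ (isLimitProdπ T i) _
    (fun n => HomologicalComplex.congr_hom (prodLift_π t n) i) _
    (fun n => HomologicalComplex.congr_hom (oneSubShift_π p n) i) _

end Complexes

/-- The truncation map `K ⟶ τ_{≥ n} K` is an isomorphism in degrees `> n`. -/
lemma isIso_πTruncGE_f (K : CochainComplex C ℤ) (n i : ℤ) (hi : n < i) :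
    IsIso ((K.πTruncGE n).f i) := by
  refine ((ComplexShape.embeddingUpIntGE n).isIso_liftExtend_f_iff (i := (i - n).toNat)
    (K.restrictionToTruncGE' (ComplexShape.embeddingUpIntGE n))
    (K.restrictionToTruncGE'_hasLift _) (by change n + ((i - n).toNat : ℤ) = i; omega)).2 ?_
  apply HomologicalComplex.isIso_restrictionToTruncGE'
  rw [ComplexShape.boundaryGE_embeddingUpIntGE_iff]
  omega

/-- The transition maps `τ_{≥ m} K ⟶ τ_{≥ n} K` between canonical truncations, for `m < n`. -/
lemma exists_truncGE_transition (K : CochainComplex C ℤ) (m n : ℤ) (h : m < n) :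
    ∃ p : K.truncGE m ⟶ K.truncGE n, K.πTruncGE m ≫ p = K.πTruncGE n := by
  have : Epi (K.πTruncGE m) := by dsimp [CochainComplex.πTruncGE]; infer_instance
  refine ⟨Abelian.epiDesc (K.πTruncGE m) (K.πTruncGE n) ?_, Abelian.comp_epiDesc _ _ _⟩
  ext i
  -- Since `m < n`, every degree is either below `n`, where the target vanishes, or above `m`, where
  -- the first truncation map is invertible and its kernel vanishes.
  by_cases hi : i < n
  · exact ((K.truncGE n).isZero_of_isStrictlyGE n i hi).eq_of_tgt _ _
  · have := isIso_πTruncGE_f K m i (by omega)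
    have h0 : (kernel.ι (K.πTruncGE m)).f i = 0 := by
      rw [← cancel_mono ((K.πTruncGE m).f i), ← HomologicalComplex.comp_f, kernel.condition]
      simp
    simp [h0]

/-- Morphisms in the derived category to a K-injective complex are represented by maps of
complexes. -/
lemma exists_Q_map_eq [HasDerivedCategory.{w} C] {X I : CochainComplex C ℤ} [I.IsKInjective]
    (g : DerivedCategory.Q.obj X ⟶ DerivedCategory.Q.obj I) :
    ∃ f : X ⟶ I, DerivedCategory.Q.map f = g := by
  let e := DerivedCategory.quotientCompQhIso C
  obtain ⟨f', hf'⟩ := (CochainComplex.IsKInjective.Qh_map_bijective _ I).surjective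
    (e.hom.app X ≫ g ≫ e.inv.app I)
  obtain ⟨f, rfl⟩ := (HomotopyCategory.quotient C (ComplexShape.up ℤ)).map_surjective f'
  refine ⟨f, ?_⟩
  rw [← cancel_epi (e.hom.app X)]
  have := e.hom.naturality f
  dsimp at this
  rw [← this, hf']
  simp

/-- Maps of complexes to a K-injective complex which agree in the derived category are homotopic. -/
lemma nonempty_homotopy_of_Q_map_eq [HasDerivedCategory.{w} C] {X I : CochainComplex C ℤ}
    [I.IsKInjective] {f g : X ⟶ I} (h : DerivedCategory.Q.map f = DerivedCategory.Q.map g) :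
    Nonempty (Homotopy f g) := by
  refine ⟨HomotopyCategory.homotopyOfEq _ _ ?_⟩
  apply (CochainComplex.IsKInjective.Qh_map_bijective _ I).injective
  rw [← cancel_mono ((DerivedCategory.quotientCompQhIso C).hom.app I)]
  have h₁ := (DerivedCategory.quotientCompQhIso C).hom.naturality f
  have h₂ := (DerivedCategory.quotientCompQhIso C).hom.naturality g
  dsimp at h₁ h₂
  rw [h₁, h₂, h]

/-- Maps to a K-injective complex extend along quasi-isomorphisms up to homotopy. -/
lemma exists_homotopy_extension {X Y I : CochainComplex C ℤ} (j : X ⟶ Y) [QuasiIso j]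
    [I.IsKInjective] (g : X ⟶ I) : ∃ f : Y ⟶ I, Nonempty (Homotopy (j ≫ f) g) := by
  let := HasDerivedCategory.standard C
  obtain ⟨f, hf⟩ := exists_Q_map_eq (inv (DerivedCategory.Q.map j) ≫ DerivedCategory.Q.map g)
  exact ⟨f, nonempty_homotopy_of_Q_map_eq (by simp [hf])⟩

/-- K-injective complexes form the right orthogonal of the acyclic ones, which is closed under cones
and shifts; the cocone is a shifted cone. -/
instance isKInjective_mappingCocone {K L : CochainComplex C ℤ} [K.IsKInjective] [L.IsKInjective]
    (φ : K ⟶ L) : (CochainComplex.mappingCocone φ).IsKInjective := by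
  have : (CochainComplex.mappingCone φ).IsKInjective := by
    rw [CochainComplex.isKInjective_iff_rightOrthogonal]
    exact ObjectProperty.ext_of_isTriangulatedClosed₃ _ _
      (HomotopyCategory.mappingCone_triangleh_distinguished φ)
      (CochainComplex.IsKInjective.rightOrthogonal K)
      (CochainComplex.IsKInjective.rightOrthogonal L)
  dsimp [CochainComplex.mappingCocone]
  infer_instance

/-- In an abelian category with enough injectives and exact countable products, every unbounded
complex has a K-injective resolution. -/
theorem exists_kInjective_resolution [EnoughInjectives C] [HasProductsOfShape ℕ C]
    [HasExactLimitsOfShape (Discrete ℕ) C] (K : CochainComplex C ℤ) :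
    ∃ (J : CochainComplex C ℤ) (f : K ⟶ J), J.IsKInjective ∧ QuasiIso f := by
  let := HasDerivedCategory.standard C
  let T (n : ℕ) : CochainComplex C ℤ := K.truncGE (-n)
  let t (n : ℕ) : K ⟶ T n := K.πTruncGE (-n)
  have (n : ℕ) : ∃ p : T (n + 1) ⟶ T n, t (n + 1) ≫ p = t n :=
    exists_truncGE_transition K _ _ (by push_cast; omega)
  choose p hp using this
  -- In degree `i` the tower is constant once `-n < i`; the inequality is strict because `τ_{≥ -n}`
  -- modifies degree `-n` itself, whence the bound `1 - i`.
  have h₁ := shortExact_prodLift_oneSubShift p t hp fun i =>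
    ⟨(1 - i).toNat, fun n hn => isIso_πTruncGE_f K _ _ (by omega)⟩
  have (n : ℕ) := CochainComplex.Plus.modelCategoryQuillen.exists_quasiIso_injective (T n) (-n)
  choose I j hj hI hI' using this
  have (n : ℕ) : (I n).IsKInjective := CochainComplex.isKInjective_of_injective (I n) (-n)
  -- The transition maps lift to the resolutions only up to homotopy, so a strict limit of the `I n`
  -- is replaced by the cocone of `oneSubShift f`.
  have (n : ℕ) := exists_homotopy_extension (j (n + 1)) (p n ≫ j n)
  choose f hf using this
  have hcomm : Homotopy (oneSubShift p ≫ prodMap j) (prodMap j ≫ oneSubShift f) :=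
    prodHomotopy fun n =>
      (Homotopy.ofEq (by simp [oneSubShift_π_assoc, sub_eq_add_neg])).trans <|
        ((Homotopy.refl (prodπ T n ≫ j n)).add
          ((hf n).some.symm.compLeft (-prodπ T (n + 1)))).trans <| Homotopy.ofEq (by
            have := prodMap_π j (n + 1)
            simp [← reassoc_of% this, sub_eq_add_neg])
  have hcomm' : DerivedCategory.Q.map (oneSubShift p) ≫ DerivedCategory.Q.map (prodMap j) =
      DerivedCategory.Q.map (prodMap j) ≫ DerivedCategory.Q.map (oneSubShift f) := by
    rw [← Functor.map_comp, ← Functor.map_comp]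
    exact DerivedCategory.Q_map_eq_of_homotopy _ hcomm
  let J := CochainComplex.mappingCocone (oneSubShift f)
  have hJ : J.IsKInjective := inferInstance
  -- The Milnor sequence of truncations and the cocone of resolutions give two triangles, isomorphic
  -- at two vertices; the third map `Q(K) ⟶ Q(J)` is an isomorphism, and comes from a map of
  -- complexes because `J` is K-injective.
  obtain ⟨a, ha₁, ha₂⟩ := Pretriangulated.complete_distinguished_triangle_morphism₁ _ _
    (DerivedCategory.triangleOfSES_distinguished h₁)
    (DerivedCategory.mappingCocone_triangle_distinguished (oneSubShift f))
    (DerivedCategory.Q.map (prodMap j)) (DerivedCategory.Q.map (prodMap j)) hcomm'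
  have ha : IsIso a := Pretriangulated.isIso₁_of_isIso₂₃ (Pretriangulated.Triangle.homMk _ _ a
    (DerivedCategory.Q.map (prodMap j)) (DerivedCategory.Q.map (prodMap j)) ha₁ hcomm' ha₂)
    (DerivedCategory.triangleOfSES_distinguished h₁)
    (DerivedCategory.mappingCocone_triangle_distinguished (oneSubShift f))
    (inferInstanceAs (IsIso (DerivedCategory.Q.map (prodMap j))))
    (inferInstanceAs (IsIso (DerivedCategory.Q.map (prodMap j))))
  change DerivedCategory.Q.obj K ⟶ DerivedCategory.Q.obj J at a
  obtain ⟨g, hg⟩ := exists_Q_map_eq a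
  refine ⟨J, g, hJ, ?_⟩
  rw [← DerivedCategory.isIso_Q_map_iff_quasiIso, hg]
  exact ha

end Towers

/-! ### K-projective resolutions by passage to the opposite category. -/

section Opposite

open Opposite

variable {C : Type u₁} [Category.{v₁} C] [Abelian C]

lemma quasiIso_of_opEquivalence_map {K L : CochainComplex C ℤ} (f : K ⟶ L)
    (h : QuasiIso ((CochainComplex.opEquivalence C).functor.map f.op)) : QuasiIso f where
  quasiIsoAt n := by
    have := h.quasiIsoAt (-n)
    rw [quasiIsoAt_iff' _ (-n - 1) (-n) (-n + 1) (by simp) (by simp)] at this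
    -- `opEquivalence` negates degrees; with `n = -m`, its short complex in degree `m` is
    -- definitionally the opposite of that of the original complex in degree `-m`.
    obtain ⟨m, rfl⟩ : ∃ m, n = -m := ⟨-n, by simp⟩
    rw [neg_neg] at this
    rw [quasiIsoAt_iff' _ (-(m + 1)) (-m) (-(m - 1)) (by simp; omega) (by simp; omega),
      ← ShortComplex.quasiIso_opMap_iff]
    exact this

/-- Products are left exact, so only epimorphisms need checking, and a product of epimorphisms in
`Cᵒᵖ` is a coproduct of monomorphisms in `C`. Of the comparison `mG` between the two, it suffices
that it is a split epimorphism. -/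
instance hasExactLimitsOfShape_op (ι : Type w) [HasCoproductsOfShape ι C]
    [HasExactColimitsOfShape (Discrete ι) C] :
    HasExactLimitsOfShape (Discrete ι) Cᵒᵖ := by
  apply +allowSynthFailures hasExactLimitsOfShape_of_preservesEpi
  constructor
  intro F G α hα
  let F' : Discrete ι ⥤ C := Discrete.functor fun n => (F.obj ⟨n⟩).unop
  let G' : Discrete ι ⥤ C := Discrete.functor fun n => (G.obj ⟨n⟩).unop
  let α' : G' ⟶ F' := Discrete.natTrans fun n => (α.app n).unop
  have (n : Discrete ι) : Mono (α'.app n) := by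
    have : Epi (α.app n) := inferInstance
    exact inferInstanceAs (Mono (α.app n).unop)
  have : Mono α' := NatTrans.mono_of_mono_app _
  have : Mono (colim.map α') := inferInstance
  let mF : op (colimit F') ⟶ limit F := limit.lift F
    { pt := op (colimit F')
      π := Discrete.natTrans fun n => (colimit.ι F' n).op }
  let mG : op (colimit G') ⟶ limit G := limit.lift G
    { pt := op (colimit G')
      π := Discrete.natTrans fun n => (colimit.ι G' n).op }
  let r : limit G ⟶ op (colimit G') := (colimit.desc G'
    { pt := (limit G).unop
      ι := Discrete.natTrans fun n => (limit.π G n).unop }).op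
  have hr : r ≫ mG = 𝟙 _ := limit.hom_ext fun n => by
    rw [Category.assoc, limit.lift_π, Category.id_comp]
    exact Quiver.Hom.unop_inj (colimit.ι_desc _ _)
  have hm : mF ≫ lim.map α = (colim.map α').op ≫ mG := limit.hom_ext fun n => by
    rw [Category.assoc, Category.assoc, lim_map, limMap_π, limit.lift_π, ← Category.assoc,
      limit.lift_π]
    exact Quiver.Hom.unop_inj (ι_colimMap α' n).symm
  have : Epi mG := epi_of_epi_fac hr
  have : Epi ((colim.map α').op ≫ mG) := inferInstance
  exact epi_of_epi_fac hm

/-- In an abelian category with enough projectives and exact countable coproducts, every unbounded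
complex has a K-projective resolution. -/
theorem exists_kProjective_resolution [EnoughProjectives C] [HasCoproductsOfShape ℕ C]
    [HasExactColimitsOfShape (Discrete ℕ) C] (K : CochainComplex C ℤ) :
    ∃ (P : CochainComplex C ℤ) (f : P ⟶ K), P.IsKProjective ∧ QuasiIso f := by
  let e := CochainComplex.opEquivalence C
  obtain ⟨J, f, hJ, hf⟩ := exists_kInjective_resolution (e.functor.obj (op K))
  let i : e.functor.obj (e.inverse.obj J) ≅ J := e.counitIso.app J
  let g : op K ⟶ e.inverse.obj J := e.functor.preimage (f ≫ i.inv)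
  refine ⟨(e.inverse.obj J).unop, g.unop, ?_, ?_⟩
  · apply CochainComplex.isKProjective_of_op
    exact CochainComplex.isKInjective_of_iso i.symm
  · apply quasiIso_of_opEquivalence_map
    change QuasiIso (e.functor.map g)
    rw [e.functor.map_preimage]
    infer_instance

end Opposite

/-! ### Resolutions in the category of representations. -/

section Instances

variable (A : Type u) [CommRing A] (G : Type u) [Group G]

/-- Functors on `BG` are modules over the group algebra. -/
def repCatEquivalence : RepCat A G ≌ ModuleCat.{u} (MonoidAlgebra A G) :=
  (Action.functorCategoryEquivalence _ _).symm.trans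
    ((Rep.repIsoAction A G).symm.trans Rep.equivalenceModuleMonoidAlgebra)

instance enoughProjectives_repCat : EnoughProjectives (RepCat A G) :=
  (repCatEquivalence A G).enoughProjectives_iff.2 inferInstance

instance enoughInjectives_repCat : EnoughInjectives (RepCat A G) :=
  (repCatEquivalence A G).enoughInjectives_iff.2 inferInstance

/-- Products in the functor category are pointwise products of modules, hence exact. -/
lemma exists_kInjective_resolution_repCat (K : CochainComplex (RepCat A G) ℤ) :
    ∃ (J : CochainComplex (RepCat A G) ℤ) (f : K ⟶ J), J.IsKInjective ∧ QuasiIso f :=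
  exists_kInjective_resolution K

lemma exists_kProjective_resolution_repCat (K : CochainComplex (RepCat A G) ℤ) :
    ∃ (P : CochainComplex (RepCat A G) ℤ) (f : P ⟶ K), P.IsKProjective ∧ QuasiIso f :=
  exists_kProjective_resolution K

end Instances

/-! ### Pointwise derived functors from K-projective and K-injective complexes. -/

section DerivedFunctors

variable {C : Type u₁} [Category.{v₁} C] [Abelian C] [HasDerivedCategory.{w} C]

/-- Morphisms in the derived category from a K-projective complex are represented by maps of
complexes. -/
lemma exists_Q_map_eq_of_isKProjective {P X : CochainComplex C ℤ} [P.IsKProjective]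
    (g : DerivedCategory.Q.obj P ⟶ DerivedCategory.Q.obj X) :
    ∃ f : P ⟶ X, DerivedCategory.Q.map f = g := by
  let e := DerivedCategory.quotientCompQhIso C
  obtain ⟨f', hf'⟩ := (CochainComplex.IsKProjective.Qh_map_bijective P _).surjective
    (e.hom.app P ≫ g ≫ e.inv.app X)
  obtain ⟨f, rfl⟩ := (HomotopyCategory.quotient C (ComplexShape.up ℤ)).map_surjective f'
  refine ⟨f, ?_⟩
  rw [← cancel_epi (e.hom.app P)]
  have := e.hom.naturality f
  dsimp at this
  rw [← this, hf']
  simp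

/-- Maps of complexes from a K-projective complex which agree in the derived category are
homotopic. -/
lemma nonempty_homotopy_of_Q_map_eq_of_isKProjective {P X : CochainComplex C ℤ}
    [P.IsKProjective] {f g : P ⟶ X} (h : DerivedCategory.Q.map f = DerivedCategory.Q.map g) :
    Nonempty (Homotopy f g) := by
  refine ⟨HomotopyCategory.homotopyOfEq _ _ ?_⟩
  apply (CochainComplex.IsKProjective.Qh_map_bijective P _).injective
  rw [← cancel_mono ((DerivedCategory.quotientCompQhIso C).hom.app X)]
  have h₁ := (DerivedCategory.quotientCompQhIso C).hom.naturality f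
  have h₂ := (DerivedCategory.quotientCompQhIso C).hom.naturality g
  dsimp at h₁ h₂
  rw [h₁, h₂, h]

section General

variable {E : Type u₂} [Category.{v₂} E] (Φ : CochainComplex C ℤ ⥤ E)

/-- A functor on complexes identifies homotopic maps. -/
def HomotopyInvariant : Prop :=
  ∀ ⦃K L : CochainComplex C ℤ⦄ (f g : K ⟶ L), Homotopy f g → Φ.map f = Φ.map g

variable {Φ}

section Left

/-- The value of a homotopy invariant functor at a K-projective complex computes its left derived
functor. -/
def kProjectiveCone (hΦ : HomotopyInvariant Φ) (P : CochainComplex C ℤ) [P.IsKProjective] :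
    Cone (StructuredArrow.proj (DerivedCategory.Q.obj P) DerivedCategory.Q ⋙ Φ) where
  pt := Φ.obj P
  π :=
    { app := fun j => Φ.map (exists_Q_map_eq_of_isKProjective j.hom).choose
      naturality := fun j k φ => by
        obtain ⟨h⟩ := nonempty_homotopy_of_Q_map_eq_of_isKProjective
          (f := (exists_Q_map_eq_of_isKProjective k.hom).choose)
          (g := (exists_Q_map_eq_of_isKProjective j.hom).choose ≫ φ.right) (by
            rw [Functor.map_comp, (exists_Q_map_eq_of_isKProjective k.hom).choose_spec,
              (exists_Q_map_eq_of_isKProjective j.hom).choose_spec]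
            exact (StructuredArrow.w φ).symm)
        have := hΦ _ _ h
        rw [Functor.map_comp] at this
        exact (Category.id_comp _).trans this }

/-- Representatives are unique up to homotopy, which `Φ` does not see, so the chosen one may be
replaced by any other. -/
lemma kProjectiveCone_π_app
    (hΦ : HomotopyInvariant Φ) (P : CochainComplex C ℤ) [P.IsKProjective]
    (j : StructuredArrow (DerivedCategory.Q.obj P) DerivedCategory.Q)
    (f : P ⟶ j.right) (hf : DerivedCategory.Q.map f = j.hom) :
    (kProjectiveCone hΦ P).π.app j = Φ.map f :=
  hΦ _ _ (nonempty_homotopy_of_Q_map_eq_of_isKProjective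
    ((exists_Q_map_eq_of_isKProjective j.hom).choose_spec.trans hf.symm)).some

lemma kProjectiveCone_π_app_id
    (hΦ : HomotopyInvariant Φ) (P : CochainComplex C ℤ) [P.IsKProjective] :
    (kProjectiveCone hΦ P).π.app (StructuredArrow.mk (𝟙 _)) = 𝟙 (Φ.obj P) :=
  (kProjectiveCone_π_app hΦ P (StructuredArrow.mk (𝟙 _)) (𝟙 P) (by simp)).trans (Φ.map_id P)

/-- The universal property of the value at a K-projective complex. -/
def isLimitKProjectiveCone
    (hΦ : HomotopyInvariant Φ) (P : CochainComplex C ℤ) [P.IsKProjective] : IsLimit (kProjectiveCone hΦ P) where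
  -- The identity of `Q(P)` maps to every object of the comma category, so a cone is determined by
  -- its component there.
  lift s := s.π.app (StructuredArrow.mk (𝟙 _))
  fac s j := by
    obtain ⟨f, hf⟩ := exists_Q_map_eq_of_isKProjective j.hom
    rw [kProjectiveCone_π_app hΦ P j f hf]
    exact s.w (StructuredArrow.homMk f (by simpa using hf) : StructuredArrow.mk (𝟙 _) ⟶ j)
  uniq s m hm := by
    have := hm (StructuredArrow.mk (𝟙 _))
    rw [kProjectiveCone_π_app_id] at this
    exact (Category.comp_id _).symm.trans this

lemma hasPointwiseLeftDerivedFunctorAt_of_isKProjective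
    (hΦ : HomotopyInvariant Φ) (P : CochainComplex C ℤ) [P.IsKProjective] :
    Φ.HasPointwiseLeftDerivedFunctorAt
      (HomologicalComplex.quasiIso C (ComplexShape.up ℤ)) P := by
  rw [Functor.hasPointwiseLeftDerivedFunctorAt_iff Φ DerivedCategory.Q]
  exact ⟨⟨_, isLimitKProjectiveCone hΦ P⟩⟩

/-- The counit at `P` is the projection of the Kan extension cone at the identity of `Q(P)`, that
is, the comparison of two limit cones. -/
lemma isIso_leftDerivedCounit_app_of_isKProjective
    (hΦ : HomotopyInvariant Φ) (P : CochainComplex C ℤ) [P.IsKProjective]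
    [Φ.HasPointwiseLeftDerivedFunctor (HomologicalComplex.quasiIso C (ComplexShape.up ℤ))]
    (LΦ : DerivedCategory C ⥤ E) (α : DerivedCategory.Q ⋙ LΦ ⟶ Φ)
    [LΦ.IsLeftDerivedFunctor α (HomologicalComplex.quasiIso C (ComplexShape.up ℤ))] :
    IsIso (α.app P) := by
  have h := Functor.isPointwiseRightKanExtensionOfHasPointwiseLeftDerivedFunctor (α := α)
    (W := HomologicalComplex.quasiIso C (ComplexShape.up ℤ)) LΦ (DerivedCategory.Q.obj P)
  have := IsLimit.conePointUniqueUpToIso_hom_comp h (isLimitKProjectiveCone hΦ P)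
    (StructuredArrow.mk (𝟙 _))
  rw [kProjectiveCone_π_app_id] at this
  have h' : (IsLimit.conePointUniqueUpToIso h (isLimitKProjectiveCone hΦ P)).hom = α.app P := by
    refine (Category.comp_id _).symm.trans (this.trans ?_)
    exact (congrArg (· ≫ α.app P) (LΦ.map_id _)).trans (Category.id_comp _)
  rw [← h']
  exact Iso.isIso_hom (IsLimit.conePointUniqueUpToIso h (isLimitKProjectiveCone hΦ P))

/-- Pointwise existence is invariant under quasi-isomorphism, so it may be tested on a resolution.
-/
lemma hasPointwiseLeftDerivedFunctor_of_exists_kProjective_resolution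
    (hΦ : HomotopyInvariant Φ)
    (hC : ∀ K : CochainComplex C ℤ, ∃ (P : CochainComplex C ℤ) (f : P ⟶ K),
      P.IsKProjective ∧ QuasiIso f) :
    Φ.HasPointwiseLeftDerivedFunctor (HomologicalComplex.quasiIso C (ComplexShape.up ℤ)) := by
  intro K
  obtain ⟨P, f, hP, hf⟩ := hC K
  rw [← Functor.hasPointwiseLeftDerivedFunctorAt_iff_of_mem Φ _ f hf]
  exact hasPointwiseLeftDerivedFunctorAt_of_isKProjective hΦ P

end Left

section Right

/-- The value of a homotopy invariant functor at a K-injective complex computes its right derived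
functor. -/
def kInjectiveCocone (hΦ : HomotopyInvariant Φ) (I : CochainComplex C ℤ) [I.IsKInjective] :
    Cocone (CostructuredArrow.proj DerivedCategory.Q (DerivedCategory.Q.obj I) ⋙ Φ) where
  pt := Φ.obj I
  ι :=
    { app := fun j => Φ.map (exists_Q_map_eq j.hom).choose
      naturality := fun j k φ => by
        obtain ⟨h⟩ := nonempty_homotopy_of_Q_map_eq
          (f := φ.left ≫ (exists_Q_map_eq k.hom).choose)
          (g := (exists_Q_map_eq j.hom).choose) (by
            rw [Functor.map_comp, (exists_Q_map_eq k.hom).choose_spec,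
              (exists_Q_map_eq j.hom).choose_spec]
            exact CostructuredArrow.w φ)
        have := hΦ _ _ h
        rw [Functor.map_comp] at this
        exact this.trans (Category.comp_id _).symm }

lemma kInjectiveCocone_ι_app
    (hΦ : HomotopyInvariant Φ) (I : CochainComplex C ℤ) [I.IsKInjective]
    (j : CostructuredArrow DerivedCategory.Q (DerivedCategory.Q.obj I))
    (f : j.left ⟶ I) (hf : DerivedCategory.Q.map f = j.hom) :
    (kInjectiveCocone hΦ I).ι.app j = Φ.map f :=
  hΦ _ _ (nonempty_homotopy_of_Q_map_eq
    ((exists_Q_map_eq j.hom).choose_spec.trans hf.symm)).some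

lemma kInjectiveCocone_ι_app_id
    (hΦ : HomotopyInvariant Φ) (I : CochainComplex C ℤ) [I.IsKInjective] :
    (kInjectiveCocone hΦ I).ι.app (CostructuredArrow.mk (𝟙 _)) = 𝟙 (Φ.obj I) :=
  (kInjectiveCocone_ι_app hΦ I (CostructuredArrow.mk (𝟙 _)) (𝟙 I) (by simp)).trans (Φ.map_id I)

/-- The universal property of the value at a K-injective complex. -/
def isColimitKInjectiveCocone
    (hΦ : HomotopyInvariant Φ) (I : CochainComplex C ℤ) [I.IsKInjective] : IsColimit (kInjectiveCocone hΦ I) where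
  desc s := s.ι.app (CostructuredArrow.mk (𝟙 _))
  fac s j := by
    obtain ⟨f, hf⟩ := exists_Q_map_eq j.hom
    rw [kInjectiveCocone_ι_app hΦ I j f hf]
    exact s.w (CostructuredArrow.homMk f (by simpa using hf) : j ⟶ CostructuredArrow.mk (𝟙 _))
  uniq s m hm := by
    have := hm (CostructuredArrow.mk (𝟙 _))
    rw [kInjectiveCocone_ι_app_id] at this
    exact (Category.id_comp _).symm.trans this

lemma hasPointwiseRightDerivedFunctorAt_of_isKInjective
    (hΦ : HomotopyInvariant Φ) (I : CochainComplex C ℤ) [I.IsKInjective] :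
    Φ.HasPointwiseRightDerivedFunctorAt
      (HomologicalComplex.quasiIso C (ComplexShape.up ℤ)) I := by
  rw [Functor.hasPointwiseRightDerivedFunctorAt_iff Φ DerivedCategory.Q]
  exact ⟨⟨_, isColimitKInjectiveCocone hΦ I⟩⟩

lemma isIso_rightDerivedUnit_app_of_isKInjective
    (hΦ : HomotopyInvariant Φ) (I : CochainComplex C ℤ) [I.IsKInjective]
    [Φ.HasPointwiseRightDerivedFunctor (HomologicalComplex.quasiIso C (ComplexShape.up ℤ))]
    (RΦ : DerivedCategory C ⥤ E) (α : Φ ⟶ DerivedCategory.Q ⋙ RΦ)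
    [RΦ.IsRightDerivedFunctor α (HomologicalComplex.quasiIso C (ComplexShape.up ℤ))] :
    IsIso (α.app I) := by
  have h := Functor.isPointwiseLeftKanExtensionOfHasPointwiseRightDerivedFunctor (α := α)
    (W := HomologicalComplex.quasiIso C (ComplexShape.up ℤ)) RΦ (DerivedCategory.Q.obj I)
  have := IsColimit.comp_coconePointUniqueUpToIso_hom (isColimitKInjectiveCocone hΦ I) h
    (CostructuredArrow.mk (𝟙 _))
  rw [kInjectiveCocone_ι_app_id] at this
  have h' : (IsColimit.coconePointUniqueUpToIso (isColimitKInjectiveCocone hΦ I) h).hom =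
      α.app I := by
    refine (Category.id_comp _).symm.trans (this.trans ?_)
    exact (congrArg (α.app I ≫ ·) (RΦ.map_id _)).trans (Category.comp_id _)
  rw [← h']
  exact Iso.isIso_hom (IsColimit.coconePointUniqueUpToIso (isColimitKInjectiveCocone hΦ I) h)

lemma hasPointwiseRightDerivedFunctor_of_exists_kInjective_resolution
    (hΦ : HomotopyInvariant Φ)
    (hC : ∀ K : CochainComplex C ℤ, ∃ (I : CochainComplex C ℤ) (f : K ⟶ I),
      I.IsKInjective ∧ QuasiIso f) :
    Φ.HasPointwiseRightDerivedFunctor (HomologicalComplex.quasiIso C (ComplexShape.up ℤ)) := by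
  intro K
  obtain ⟨I, f, hI, hf⟩ := hC K
  rw [Functor.hasPointwiseRightDerivedFunctorAt_iff_of_mem Φ _ f hf]
  exact hasPointwiseRightDerivedFunctorAt_of_isKInjective hΦ I

end Right

end General

end DerivedFunctors

lemma homotopyInvariant_toDerived {C : Type u₁} [Category.{v₁} C] [Abelian C]
    {D : Type u₂} [Category.{v₂} D] [Abelian D]
    [HasDerivedCategory.{w} D] (F : C ⥤ D) [F.Additive] : HomotopyInvariant (toDerived F) :=
  fun _ _ _ _ h => DerivedCategory.Q_map_eq_of_homotopy _ (F.mapHomotopy h)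

/-! ### Composition of total derived functors. -/

section Composition

variable {C : Type u₁} {D : Type u₂} {E : Type u₃} [Category.{v₁} C] [Category.{v₂} D]
  [Category.{v₃} E] [Abelian C] [Abelian D] [Abelian E]

lemma isInvertedBy_toDerived [HasDerivedCategory.{w} D] (F : C ⥤ D) [F.Additive]
    [PreservesFiniteLimits F] [PreservesFiniteColimits F] :
    (HomologicalComplex.quasiIso C (ComplexShape.up ℤ)).IsInvertedBy (toDerived F) := by
  intro K L f hf
  have : QuasiIso f := hf
  have := HomologicalComplex.quasiIso_map_of_preservesHomology f F
  exact inferInstanceAs (IsIso (DerivedCategory.Q.map _))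

lemma acyclic_mapHomologicalComplex (F : C ⥤ D) [F.Additive]
    [PreservesFiniteLimits F] [PreservesFiniteColimits F] {K : CochainComplex C ℤ}
    (hK : K.Acyclic) : ((F.mapHomologicalComplex (ComplexShape.up ℤ)).obj K).Acyclic :=
  fun n => (hK n).map F

/-- A map from `F(P)` to an acyclic `L` is transposed to `P ⟶ R(L)`, which is null-homotopic since
`R(L)` is acyclic; `F` and the counit carry the homotopy back. -/
lemma isKProjective_mapHomologicalComplex {F : C ⥤ D} {R : D ⥤ C} (adj : F ⊣ R) [F.Additive]
    [R.Additive] [PreservesFiniteLimits R] [PreservesFiniteColimits R] (P : CochainComplex C ℤ)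
    [P.IsKProjective] :
    CochainComplex.IsKProjective ((F.mapHomologicalComplex (ComplexShape.up ℤ)).obj P) where
  nonempty_homotopy_zero {L} f hL := by
    let g : P ⟶ (R.mapHomologicalComplex (ComplexShape.up ℤ)).obj L :=
      { f := fun i => adj.homEquiv _ _ (f.f i)
        comm' := fun i j _ => by
          have h₁ := adj.homEquiv_naturality_right (f.f i) (L.d i j)
          have h₂ := adj.homEquiv_naturality_left (P.d i j) (f.f j)
          exact h₁.symm.trans ((congrArg _ (f.comm i j)).trans h₂) }
    have h := CochainComplex.IsKProjective.homotopyZero g (acyclic_mapHomologicalComplex R hL)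
    let ε : (R.mapHomologicalComplex (ComplexShape.up ℤ) ⋙
        F.mapHomologicalComplex (ComplexShape.up ℤ)).obj L ⟶ L :=
      { f := fun i => adj.counit.app _
        comm' := fun i j _ => (adj.counit.naturality (L.d i j)).symm }
    have hf : f = (F.mapHomologicalComplex (ComplexShape.up ℤ)).map g ≫ ε := by
      ext i
      exact ((adj.homEquiv_counit _ _ _).symm.trans ((adj.homEquiv _ _).symm_apply_apply (f.f i))).symm
    rw [hf]
    exact ⟨((F.mapHomotopy h).compRight ε).trans (Homotopy.ofEq (by simp))⟩

lemma isKInjective_mapHomologicalComplex {F : C ⥤ D} {R : D ⥤ C} (adj : F ⊣ R) [F.Additive]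
    [R.Additive] [PreservesFiniteLimits F] [PreservesFiniteColimits F] (I : CochainComplex D ℤ)
    [I.IsKInjective] :
    CochainComplex.IsKInjective ((R.mapHomologicalComplex (ComplexShape.up ℤ)).obj I) where
  nonempty_homotopy_zero {L} f hL := by
    let g : (F.mapHomologicalComplex (ComplexShape.up ℤ)).obj L ⟶ I :=
      { f := fun i => (adj.homEquiv _ _).symm (f.f i)
        comm' := fun i j _ => by
          have h₁ := adj.homEquiv_naturality_right_symm (f.f i) (I.d i j)
          have h₂ := adj.homEquiv_naturality_left_symm (L.d i j) (f.f j)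
          exact h₁.symm.trans ((congrArg _ (f.comm i j)).trans h₂) }
    have h := CochainComplex.IsKInjective.homotopyZero g (acyclic_mapHomologicalComplex F hL)
    let η : L ⟶ (F.mapHomologicalComplex (ComplexShape.up ℤ) ⋙
        R.mapHomologicalComplex (ComplexShape.up ℤ)).obj L :=
      { f := fun i => adj.unit.app _
        comm' := fun i j _ => (adj.unit.naturality (L.d i j)).symm }
    have hf : f = η ≫ (R.mapHomologicalComplex (ComplexShape.up ℤ)).map g := by
      ext i
      exact ((adj.homEquiv_unit _ _ _).symm.trans ((adj.homEquiv _ _).apply_symm_apply (f.f i))).symm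
    rw [hf]
    exact ⟨((R.mapHomotopy h).compLeft η).trans (Homotopy.ofEq (by simp))⟩

variable [HasDerivedCategory.{w} C] [HasDerivedCategory.{w} D] [HasDerivedCategory.{w} E]
  {F : C ⥤ D} {G : D ⥤ E} {H : C ⥤ E} [F.Additive] [G.Additive] [H.Additive]

/-- The canonical morphism from a composition of left derived functors to the composition of the
functors, up to an isomorphism `F ⋙ G ≅ H`. -/
def leftDerivedCompCounit [HasL F] [HasL G] (τ : F ⋙ G ≅ H) :
    DerivedCategory.Q ⋙ L F ⋙ L G ⟶ toDerived H :=
  Functor.whiskerRight (LCounit F) (L G) ≫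
    Functor.whiskerLeft (F.mapHomologicalComplex (ComplexShape.up ℤ)) (LCounit G) ≫
    Functor.whiskerRight (NatTrans.mapHomologicalComplex τ.hom (ComplexShape.up ℤ))
      DerivedCategory.Q

/-- Left derived functors compose, when the first functor preserves K-projective complexes. -/
theorem exists_leftDerived_comp_iso
    (hC : ∀ K : CochainComplex C ℤ, ∃ (P : CochainComplex C ℤ) (f : P ⟶ K),
      P.IsKProjective ∧ QuasiIso f)
    (hD : ∀ K : CochainComplex D ℤ, ∃ (P : CochainComplex D ℤ) (f : P ⟶ K),
      P.IsKProjective ∧ QuasiIso f)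
    (hF : ∀ P : CochainComplex C ℤ, P.IsKProjective →
      CochainComplex.IsKProjective ((F.mapHomologicalComplex (ComplexShape.up ℤ)).obj P))
    [HasL F] [HasL G] [HasL H] (τ : F ⋙ G ≅ H) :
    ∃ e : L F ⋙ L G ≅ L H, ∀ K : CochainComplex C ℤ,
      e.hom.app (DerivedCategory.Q.obj K) ≫ (LCounit H).app K =
        (L G).map ((LCounit F).app K) ≫
          (LCounit G).app ((F.mapHomologicalComplex (ComplexShape.up ℤ)).obj K) ≫
          DerivedCategory.Q.map
            ((NatTrans.mapHomologicalComplex τ.hom (ComplexShape.up ℤ)).app K) := by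
  let β := leftDerivedCompCounit τ
  let W := HomologicalComplex.quasiIso C (ComplexShape.up ℤ)
  -- The comparison comes from the universal property of `L H`, so its compatibility with the
  -- counits holds by construction and only invertibility is left.
  let e := (L H).leftDerivedLift (LCounit H) W _ β
  have he (K : CochainComplex C ℤ) :
      e.app (DerivedCategory.Q.obj K) ≫ (LCounit H).app K = β.app K :=
    Functor.leftDerived_fac_app _ _ _ _ _ _
  have := hasPointwiseLeftDerivedFunctor_of_exists_kProjective_resolution
    (homotopyInvariant_toDerived F) hC
  have := hasPointwiseLeftDerivedFunctor_of_exists_kProjective_resolution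
    (homotopyInvariant_toDerived G) hD
  have := hasPointwiseLeftDerivedFunctor_of_exists_kProjective_resolution
    (homotopyInvariant_toDerived H) hC
  have hP (P : CochainComplex C ℤ) [P.IsKProjective] : IsIso (e.app (DerivedCategory.Q.obj P)) := by
    have hFP := hF P inferInstance
    have h₁ : IsIso ((LCounit F).app P) :=
      isIso_leftDerivedCounit_app_of_isKProjective (homotopyInvariant_toDerived F) P _ _
    have h₂ : IsIso ((LCounit G).app ((F.mapHomologicalComplex (ComplexShape.up ℤ)).obj P)) :=
      isIso_leftDerivedCounit_app_of_isKProjective (homotopyInvariant_toDerived G) _ _ _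
    have h₃ : IsIso ((LCounit H).app P) :=
      isIso_leftDerivedCounit_app_of_isKProjective (homotopyInvariant_toDerived H) P _ _
    have h₄ : IsIso (DerivedCategory.Q.map
        ((NatTrans.mapHomologicalComplex τ.hom (ComplexShape.up ℤ)).app P)) :=
      (DerivedCategory.Q.mapIso ((NatIso.mapHomologicalComplex τ _).app P)).isIso_hom
    have h₅ : IsIso (β.app P) :=
      IsIso.comp_isIso' (Functor.map_isIso _ _) (IsIso.comp_isIso' h₂ h₄)
    rw [← he] at h₅
    exact IsIso.of_isIso_comp_right _ ((LCounit H).app P)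
  have : IsIso e := by
    rw [NatTrans.isIso_iff_isIso_app]
    intro X
    obtain ⟨P, f, _, _⟩ := hC (DerivedCategory.Q.objPreimage X)
    -- Every object of the derived category is the image of a K-projective complex, so invertibility
    -- there suffices.
    let i : DerivedCategory.Q.obj P ≅ X :=
      asIso (DerivedCategory.Q.map f) ≪≫ DerivedCategory.Q.objObjPreimageIso X
    exact (NatTrans.isIso_app_iff_of_iso e i).1 (hP P)
  exact ⟨asIso e, fun K => he K⟩

/-- The canonical morphism from the composition of the functors to a composition of right derived
functors, up to an isomorphism `F ⋙ G ≅ H`. -/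
def rightDerivedCompUnit [HasR F] [HasR G] (τ : F ⋙ G ≅ H) :
    toDerived H ⟶ DerivedCategory.Q ⋙ R F ⋙ R G :=
  Functor.whiskerRight (NatTrans.mapHomologicalComplex τ.inv (ComplexShape.up ℤ))
      DerivedCategory.Q ≫
    Functor.whiskerLeft (F.mapHomologicalComplex (ComplexShape.up ℤ)) (RUnit G) ≫
    Functor.whiskerRight (RUnit F) (R G)

/-- Right derived functors compose, when the first functor preserves K-injective complexes. -/
theorem exists_rightDerived_comp_iso
    (hC : ∀ K : CochainComplex C ℤ, ∃ (I : CochainComplex C ℤ) (f : K ⟶ I),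
      I.IsKInjective ∧ QuasiIso f)
    (hD : ∀ K : CochainComplex D ℤ, ∃ (I : CochainComplex D ℤ) (f : K ⟶ I),
      I.IsKInjective ∧ QuasiIso f)
    (hF : ∀ I : CochainComplex C ℤ, I.IsKInjective →
      CochainComplex.IsKInjective ((F.mapHomologicalComplex (ComplexShape.up ℤ)).obj I))
    [HasR F] [HasR G] [HasR H] (τ : F ⋙ G ≅ H) :
    ∃ e : R F ⋙ R G ≅ R H, ∀ K : CochainComplex C ℤ,
      (RUnit G).app ((F.mapHomologicalComplex (ComplexShape.up ℤ)).obj K) ≫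
          (R G).map ((RUnit F).app K) ≫ e.hom.app (DerivedCategory.Q.obj K) =
        DerivedCategory.Q.map
            ((NatTrans.mapHomologicalComplex τ.hom (ComplexShape.up ℤ)).app K) ≫
          (RUnit H).app K := by
  let β := rightDerivedCompUnit τ
  let W := HomologicalComplex.quasiIso C (ComplexShape.up ℤ)
  let e := (R H).rightDerivedDesc (RUnit H) W _ β
  have he (K : CochainComplex C ℤ) :
      (RUnit H).app K ≫ e.app (DerivedCategory.Q.obj K) = β.app K :=
    Functor.rightDerived_fac_app _ _ _ _ _ _
  have := hasPointwiseRightDerivedFunctor_of_exists_kInjective_resolution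
    (homotopyInvariant_toDerived F) hC
  have := hasPointwiseRightDerivedFunctor_of_exists_kInjective_resolution
    (homotopyInvariant_toDerived G) hD
  have := hasPointwiseRightDerivedFunctor_of_exists_kInjective_resolution
    (homotopyInvariant_toDerived H) hC
  have hI (I : CochainComplex C ℤ) [I.IsKInjective] : IsIso (e.app (DerivedCategory.Q.obj I)) := by
    have hFI := hF I inferInstance
    have h₁ : IsIso ((RUnit F).app I) :=
      isIso_rightDerivedUnit_app_of_isKInjective (homotopyInvariant_toDerived F) I _ _
    have h₂ : IsIso ((RUnit G).app ((F.mapHomologicalComplex (ComplexShape.up ℤ)).obj I)) :=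
      isIso_rightDerivedUnit_app_of_isKInjective (homotopyInvariant_toDerived G) _ _ _
    have h₃ : IsIso ((RUnit H).app I) :=
      isIso_rightDerivedUnit_app_of_isKInjective (homotopyInvariant_toDerived H) I _ _
    have h₄ : IsIso (DerivedCategory.Q.map
        ((NatTrans.mapHomologicalComplex τ.inv (ComplexShape.up ℤ)).app I)) :=
      (DerivedCategory.Q.mapIso ((NatIso.mapHomologicalComplex τ _).app I)).isIso_inv
    have h₅ : IsIso (β.app I) :=
      IsIso.comp_isIso' h₄ (IsIso.comp_isIso' h₂ (Functor.map_isIso _ _))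
    rw [← he] at h₅
    exact IsIso.of_isIso_comp_left ((RUnit H).app I) _
  have : IsIso e := by
    rw [NatTrans.isIso_iff_isIso_app]
    intro X
    obtain ⟨I, f, _, _⟩ := hC (DerivedCategory.Q.objPreimage X)
    let i : DerivedCategory.Q.obj I ≅ X :=
      (asIso (DerivedCategory.Q.map f)).symm ≪≫ DerivedCategory.Q.objObjPreimageIso X
    exact (NatTrans.isIso_app_iff_of_iso e i).1 (hI I)
  -- The universal property of `R H` produces a map out of it, opposite to the required direction;
  -- the compatibility must therefore be transported to the inverses of `e` and `τ`.
  refine ⟨(asIso e).symm, fun K => ?_⟩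
  have hτ : DerivedCategory.Q.map
        ((NatTrans.mapHomologicalComplex τ.hom (ComplexShape.up ℤ)).app K) ≫
      DerivedCategory.Q.map
        ((NatTrans.mapHomologicalComplex τ.inv (ComplexShape.up ℤ)).app K) = 𝟙 _ :=
    (DerivedCategory.Q.mapIso ((NatIso.mapHomologicalComplex τ _).app K)).hom_inv_id
  have h : (RUnit G).app ((F.mapHomologicalComplex (ComplexShape.up ℤ)).obj K) ≫
        (R G).map ((RUnit F).app K) =
      DerivedCategory.Q.map
        ((NatTrans.mapHomologicalComplex τ.hom (ComplexShape.up ℤ)).app K) ≫ β.app K := by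
    change _ = _ ≫ DerivedCategory.Q.map _ ≫ _ ≫ _
    exact ((Category.assoc _ _ _).symm.trans ((congrArg (· ≫ _) hτ).trans
      (Category.id_comp _))).symm
  refine (Category.assoc _ _ _).symm.trans ((congrArg (· ≫ _) (h.trans
    (congrArg (_ ≫ ·) (he K).symm))).trans ?_)
  refine (Category.assoc _ _ _).trans (congrArg (_ ≫ ·) ((Category.assoc _ _ _).trans ?_))
  exact (congrArg ((RUnit H).app K ≫ ·) (Iso.hom_inv_id_app (asIso e) _)).trans
    (Category.comp_id _)

end Composition

/-! ### Thin groupoids are essentially discrete. -/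

section ThinGroupoid

variable (J : Type u₁) [Groupoid.{v₁} J]

/-- A groupoid with at most one morphism between any two objects is equivalent to the discrete
category on its connected components. -/
def discreteEquivalence [Quiver.IsThin J] : Discrete (ConnectedComponents J) ≌ J :=
  let F : Discrete (ConnectedComponents J) ⥤ J := Discrete.functor fun c => Quotient.out c
  have : F.Faithful := ⟨fun _ => Subsingleton.elim _ _⟩
  have : F.Full := ⟨fun {X Y} f => by
    obtain ⟨X⟩ := X
    obtain ⟨Y⟩ := Y
    obtain rfl : X = Y := by
      rw [← Quotient.out_eq X, ← Quotient.out_eq Y]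
      exact Quotient.sound (Zigzag.of_hom f)
    exact ⟨𝟙 _, Subsingleton.elim _ _⟩⟩
  have : F.EssSurj := ⟨fun j => ⟨⟨Quotient.mk (Zigzag.setoid J) j⟩, by
    have h : Zigzag (Quotient.out (Quotient.mk (Zigzag.setoid J) j)) j :=
      Quotient.mk_out (s := Zigzag.setoid J) j
    change Nonempty (Quotient.out (Quotient.mk (Zigzag.setoid J) j) ≅ j)
    generalize Quotient.out (Quotient.mk (Zigzag.setoid J) j) = i at h
    -- As all morphisms are invertible, a zigzag composes to an isomorphism.
    induction h with
    | refl => exact ⟨Iso.refl _⟩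
    | tail _ h ih =>
      obtain ⟨i⟩ := ih
      obtain ⟨⟨f⟩⟩ | ⟨⟨f⟩⟩ := h
      · exact ⟨i ≪≫ asIso f⟩
      · exact ⟨i ≪≫ (asIso f).symm⟩⟩⟩
  have : F.IsEquivalence := {}
  F.asEquivalence

end ThinGroupoid

/-! ### Exactness of the Kan extensions along the inclusion of a subgroup. -/

section Kan

variable (A : Type u) [CommRing A] {G : Type u} [Group G] (H : Subgroup G)

/-- Objects of the comma category are elements of `G` and morphisms are translations by elements of
`H`; cancellation in `G` gives uniqueness, and the components are the cosets of `H`. -/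
instance thin_costructuredArrow (X : SingleObj G) : Quiver.IsThin (CostructuredArrow (Bι H) X) :=
  fun a b => ⟨fun f g => by
    ext
    have h₁ := CostructuredArrow.w f
    have h₂ := CostructuredArrow.w g
    rw [← h₂] at h₁
    exact Subtype.ext (mul_left_cancel h₁)⟩

instance thin_structuredArrow (X : SingleObj G) : Quiver.IsThin (StructuredArrow X (Bι H)) :=
  fun a b => ⟨fun f g => by
    ext
    have h₁ := StructuredArrow.w f
    have h₂ := StructuredArrow.w g
    rw [← h₂] at h₁
    exact Subtype.ext (mul_right_cancel h₁)⟩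

/-- The comma category of `Bι` over an object of `BG` is a groupoid. -/
instance groupoid_costructuredArrow (X : SingleObj G) : Groupoid (CostructuredArrow (Bι H) X) :=
  Groupoid.ofIsIso fun f => by
    have : IsIso ((CostructuredArrow.proj (Bι H) X).map f) :=
      IsIso.of_groupoid (C := SingleObj H) f.left
    exact isIso_of_reflects_iso f (CostructuredArrow.proj (Bι H) X)

/-- The comma category of `Bι` under an object of `BG` is a groupoid. -/
instance groupoid_structuredArrow (X : SingleObj G) : Groupoid (StructuredArrow X (Bι H)) :=
  Groupoid.ofIsIso fun f => by
    have : IsIso ((StructuredArrow.proj X (Bι H)).map f) :=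
      IsIso.of_groupoid (C := SingleObj H) f.right
    exact isIso_of_reflects_iso f (StructuredArrow.proj X (Bι H))

instance hasExactColimitsOfShape_costructuredArrow (X : SingleObj G) :
    HasExactColimitsOfShape (CostructuredArrow (Bι H) X) (ModuleCat.{u} A) :=
  HasExactColimitsOfShape.of_domain_equivalence _
    (discreteEquivalence (CostructuredArrow (Bι H) X))

instance hasExactLimitsOfShape_structuredArrow (X : SingleObj G) :
    HasExactLimitsOfShape (StructuredArrow X (Bι H)) (ModuleCat.{u} A) :=
  HasExactLimitsOfShape.of_domain_equivalence _
    (discreteEquivalence (StructuredArrow X (Bι H)))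

variable {A}

/-- Naturality in the representation of the pointwise colimit formula; it reduces exactness of
`shriek` to that of colimits over comma categories. -/
lemma leftKanExtensionObjIsoColimit_inv_naturality {M N : RepCat A H} (φ : M ⟶ N)
    (X : SingleObj G) :
    ((Bι H).leftKanExtensionObjIsoColimit M X).inv ≫ ((shriek A H).map φ).app X =
      colimMap (Functor.whiskerLeft (CostructuredArrow.proj (Bι H) X) φ) ≫
        ((Bι H).leftKanExtensionObjIsoColimit N X).inv := by
  refine colimit.hom_ext fun f => ?_
  have h₁ := (Bι H).ι_leftKanExtensionObjIsoColimit_inv M X f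
  have h₂ := (Bι H).ι_leftKanExtensionObjIsoColimit_inv N X f
  have h₃ := congrArg (fun t => t.app f.left) ((Bι H).lanUnit.naturality φ)
  have h₄ := ι_colimMap (Functor.whiskerLeft (CostructuredArrow.proj (Bι H) X) φ) f
  have h₅ := ((shriek A H).map φ).naturality f.hom
  have h₆ : colimit.ι _ f ≫ ((Bι H).leftKanExtensionObjIsoColimit M X).inv ≫
        ((shriek A H).map φ).app X =
      (φ.app f.left ≫ ((Bι H).leftKanExtensionUnit N).app f.left) ≫
        ((Bι H).leftKanExtension N).map f.hom :=
    ((Category.assoc _ _ _).symm.trans (congrArg (· ≫ _) h₁)).trans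
      ((Category.assoc _ _ _).trans ((congrArg (_ ≫ ·) h₅).trans
        ((Category.assoc _ _ _).symm.trans (congrArg (· ≫ _) h₃.symm))))
  exact h₆.trans ((Category.assoc _ _ _).trans ((congrArg (_ ≫ ·) h₂.symm).trans
    ((Category.assoc _ _ _).symm.trans ((congrArg (· ≫ _) h₄.symm).trans
      (Category.assoc _ _ _)))))

lemma ranObjObjIsoLimit_hom_naturality {M N : RepCat A H} (φ : M ⟶ N) (X : SingleObj G) :
    ((star A H).map φ).app X ≫ ((Bι H).ranObjObjIsoLimit N X).hom =
      ((Bι H).ranObjObjIsoLimit M X).hom ≫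
        limMap (Functor.whiskerLeft (StructuredArrow.proj X (Bι H)) φ) := by
  refine limit.hom_ext fun f => ?_
  have h₁ := (Bι H).ranObjObjIsoLimit_hom_π M X f
  have h₂ := (Bι H).ranObjObjIsoLimit_hom_π N X f
  have h₃ := congrArg (fun t => t.app f.right) ((Bι H).ranCounit.naturality φ)
  have h₄ := limMap_π (Functor.whiskerLeft (StructuredArrow.proj X (Bι H)) φ) f
  have h₅ := ((star A H).map φ).naturality f.hom
  calc
    _ = ((star A H).map φ).app X ≫ ((star A H).obj N).map f.hom ≫
          ((Bι H).ranCounit.app N).app f.right :=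
      (Category.assoc _ _ _).trans (congrArg (_ ≫ ·) h₂)
    _ = ((star A H).obj M).map f.hom ≫ ((Bι H).ranCounit.app M).app f.right ≫
          φ.app f.right :=
      (Category.assoc _ _ _).symm.trans ((congrArg (· ≫ _) h₅.symm).trans
        ((Category.assoc _ _ _).trans (congrArg (_ ≫ ·) h₃)))
    _ = _ :=
      (Category.assoc _ _ _).symm.trans ((congrArg (· ≫ _) h₁.symm).trans
        ((Category.assoc _ _ _).trans ((congrArg (_ ≫ ·) h₄.symm).trans
          (Category.assoc _ _ _).symm)))

variable (A)

/-- Pointwise, `Bι_!` is a colimit over a thin groupoid, hence a direct sum of modules, and direct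
sums preserve injectivity. -/
instance preservesMonomorphisms_shriek : (shriek A H).PreservesMonomorphisms where
  preserves {M N} φ _ := by
    rw [NatTrans.mono_iff_mono_app]
    intro X
    have hφ := (NatTrans.mono_iff_mono_app φ).1 ‹_›
    have : Mono (Functor.whiskerLeft (CostructuredArrow.proj (Bι H) X) φ) :=
      (NatTrans.mono_iff_mono_app _).2 fun f => hφ f.left
    have : Mono (colimMap (Functor.whiskerLeft (CostructuredArrow.proj (Bι H) X) φ)) :=
      Functor.map_mono colim (Functor.whiskerLeft (CostructuredArrow.proj (Bι H) X) φ)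
    let i (K : RepCat A H) : ((shriek A H).obj K).obj X ≅
        colimit (CostructuredArrow.proj (Bι H) X ⋙ K) :=
      (Bι H).leftKanExtensionObjIsoColimit K X
    have h : ((shriek A H).map φ).app X = (i M).hom ≫
        colimMap (Functor.whiskerLeft (CostructuredArrow.proj (Bι H) X) φ) ≫ (i N).inv :=
      (i M).inv_comp_eq.1 (leftKanExtensionObjIsoColimit_inv_naturality H φ X)
    rw [h]
    infer_instance

instance preservesEpimorphisms_star : (star A H).PreservesEpimorphisms where
  preserves {M N} φ _ := by
    rw [NatTrans.epi_iff_epi_app]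
    intro X
    have hφ := (NatTrans.epi_iff_epi_app φ).1 ‹_›
    have : Epi (Functor.whiskerLeft (StructuredArrow.proj X (Bι H)) φ) :=
      (NatTrans.epi_iff_epi_app _).2 fun f => hφ f.right
    have : Epi (limMap (Functor.whiskerLeft (StructuredArrow.proj X (Bι H)) φ)) :=
      Functor.map_epi lim (Functor.whiskerLeft (StructuredArrow.proj X (Bι H)) φ)
    let i (K : RepCat A H) : ((star A H).obj K).obj X ≅
        limit (StructuredArrow.proj X (Bι H) ⋙ K) :=
      (Bι H).ranObjObjIsoLimit K X
    have h : ((star A H).map φ).app X = ((i M).hom ≫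
        limMap (Functor.whiskerLeft (StructuredArrow.proj X (Bι H)) φ)) ≫ (i N).inv :=
      (i N).eq_comp_inv.2 (ranObjObjIsoLimit_hom_naturality H φ X)
    rw [h]
    infer_instance

instance preservesFiniteColimits_shriek : PreservesFiniteColimits (shriek A H) :=
  have : PreservesColimitsOfSize.{0, 0} (shriek A H) :=
    ((Bι H).lanAdjunction (ModuleCat.{u} A)).leftAdjoint_preservesColimits
  inferInstance

instance preservesFiniteLimits_star : PreservesFiniteLimits (star A H) :=
  have : PreservesLimitsOfSize.{0, 0} (star A H) :=
    ((Bι H).ranAdjunction (ModuleCat.{u} A)).rightAdjoint_preservesLimits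
  inferInstance

/-- A left adjoint is right exact, so preserving monomorphisms makes it exact. -/
instance preservesFiniteLimits_shriek : PreservesFiniteLimits (shriek A H) :=
  have := (shriek A H).preservesHomology_of_preservesMonos_and_cokernels
  (shriek A H).preservesFiniteLimits_of_preservesHomology

instance preservesFiniteColimits_star : PreservesFiniteColimits (star A H) :=
  have := (star A H).preservesHomology_of_preservesEpis_and_kernels
  (star A H).preservesFiniteColimits_of_preservesHomology

instance additive_whiskeringLeft_B :
    ((Functor.whiskeringLeft _ _ (ModuleCat.{u} A)).obj (Bι H)).Additive where
  map_add := rfl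

instance preservesFiniteLimits_whiskeringLeft_B :
    PreservesFiniteLimits ((Functor.whiskeringLeft _ _ (ModuleCat.{u} A)).obj (Bι H)) :=
  ⟨fun _ => inferInstance⟩

instance preservesFiniteColimits_whiskeringLeft_B :
    PreservesFiniteColimits ((Functor.whiskeringLeft _ _ (ModuleCat.{u} A)).obj (Bι H)) :=
  ⟨fun _ => inferInstance⟩

section Derived

lemma isIso_LCounit_of_exact {C : Type u₁} {D : Type u₂} [Category.{v₁} C] [Category.{v₂} D]
    [Abelian C] [Abelian D] [HasDerivedCategory.{w} C] [HasDerivedCategory.{w} D] (F : C ⥤ D)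
    [F.Additive] [PreservesFiniteLimits F] [PreservesFiniteColimits F] [HasL F] :
    IsIso (LCounit F) :=
  Functor.isIso_of_isLeftDerivedFunctor_of_inverts _ _ (isInvertedBy_toDerived F)

lemma isIso_RUnit_of_exact {C : Type u₁} {D : Type u₂} [Category.{v₁} C] [Category.{v₂} D]
    [Abelian C] [Abelian D] [HasDerivedCategory.{w} C] [HasDerivedCategory.{w} D] (F : C ⥤ D)
    [F.Additive] [PreservesFiniteLimits F] [PreservesFiniteColimits F] [HasR F] :
    IsIso (RUnit F) :=
  Functor.isIso_of_isRightDerivedFunctor_of_inverts _ _ (isInvertedBy_toDerived F)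

lemma hasL_of_additive [HasDerivedCategory.{w} (RepCat A G)]
    {C : Type u₂} [Category.{v₂} C] [Abelian C] [HasDerivedCategory.{w} C]
    (F : RepCat A G ⥤ C) [F.Additive] : HasL F :=
  have := hasPointwiseLeftDerivedFunctor_of_exists_kProjective_resolution
    (homotopyInvariant_toDerived F) (exists_kProjective_resolution_repCat A G)
  inferInstance

lemma hasR_of_additive [HasDerivedCategory.{w} (RepCat A G)]
    {C : Type u₂} [Category.{v₂} C] [Abelian C] [HasDerivedCategory.{w} C]
    (F : RepCat A G ⥤ C) [F.Additive] : HasR F :=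
  have := hasPointwiseRightDerivedFunctor_of_exists_kInjective_resolution
    (homotopyInvariant_toDerived F) (exists_kInjective_resolution_repCat A G)
  inferInstance

end Derived

end Kan

/-! ### The derived Shapiro isomorphisms. -/

section Main

variable {A G : Type u} [CommRing A] [Group G] (H : Subgroup G)
  [HasDerivedCategory.{w} (ModuleCat.{u} A)] [HasDerivedCategory.{w} (RepCat A G)]
  [HasDerivedCategory.{w} (RepCat A H)]

/-- The derived Shapiro lemma for the left derived functors of the colimit functors. -/
theorem exists_leftDerived_colim_shriek_iso :
    ∃ (_ : HasL (colimB A G)) (_ : HasL (colimB A H)) (_ : HasL (shriek A H)),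
      IsIso (LCounit (shriek A H)) ∧
      ∃ e : L (shriek A H) ⋙ L (colimB A G) ≅ L (colimB A H),
        ∀ K : CochainComplex (RepCat A H) ℤ,
          e.hom.app (DerivedCategory.Q.obj K) ≫ (LCounit (colimB A H)).app K =
            (L (colimB A G)).map ((LCounit (shriek A H)).app K) ≫
              (LCounit (colimB A G)).app
                (((shriek A H).mapHomologicalComplex (ComplexShape.up ℤ)).obj K) ≫
              DerivedCategory.Q.map (colimComparison A H K) := by
  have h₁ := hasL_of_additive A (colimB A G)
  have h₂ := hasL_of_additive A (colimB A H)
  have h₃ := hasL_of_additive A (shriek A H)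
  exact ⟨h₁, h₂, h₃, isIso_LCounit_of_exact _,
    exists_leftDerived_comp_iso (exists_kProjective_resolution_repCat A H)
      (exists_kProjective_resolution_repCat A G)
      -- The right adjoint of `Bι_!` is restriction along `Bι`, which is exact because limits and
      -- colimits of diagrams are pointwise.
      (fun P _ => isKProjective_mapHomologicalComplex
        ((Bι H).lanAdjunction (ModuleCat.{u} A)) P)
      ((Bι H).lanCompColimIso)⟩

/-- The derived Shapiro lemma for the right derived functors of the limit functors. -/
theorem exists_rightDerived_lim_star_iso :
    ∃ (_ : HasR (limB A G)) (_ : HasR (limB A H)) (_ : HasR (star A H)),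
      IsIso (RUnit (star A H)) ∧
      ∃ e : R (star A H) ⋙ R (limB A G) ≅ R (limB A H),
        ∀ K : CochainComplex (RepCat A H) ℤ,
          (RUnit (limB A G)).app
                (((star A H).mapHomologicalComplex (ComplexShape.up ℤ)).obj K) ≫
              (R (limB A G)).map ((RUnit (star A H)).app K) ≫
              e.hom.app (DerivedCategory.Q.obj K) =
            DerivedCategory.Q.map (limComparison A H K) ≫ (RUnit (limB A H)).app K := by
  have h₁ := hasR_of_additive A (limB A G)
  have h₂ := hasR_of_additive A (limB A H)
  have h₃ := hasR_of_additive A (star A H)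
  exact ⟨h₁, h₂, h₃, isIso_RUnit_of_exact _,
    exists_rightDerived_comp_iso (exists_kInjective_resolution_repCat A H)
      (exists_kInjective_resolution_repCat A G)
      (fun I _ => isKInjective_mapHomologicalComplex
        ((Bι H).ranAdjunction (ModuleCat.{u} A)) I)
      ((Bι H).ranCompLimIso)⟩

end Main

/-! ### Comparison of the bar resolutions of `H` and `G`. -/

section BarResolution

variable (A : Type u) {G : Type u} [CommRing A] [Group G] (H : Subgroup G)

/-- The map `(Hⁿ →₀ A[H]) ⟶ (Gⁿ →₀ A[G])` of representations of `H` induced by the inclusion. -/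
def freeMap (n : ℕ) :
    (Representation.free A H (Fin n → H)).IntertwiningMap
      ((Representation.free A G (Fin n → G)).comp H.subtype) :=
  Representation.freeLift _ fun x => Finsupp.single (H.subtype ∘ x) (.single 1 1)

lemma freeMap_single (n : ℕ) (x : Fin n → H) (h : H) (r : A) :
    freeMap A H n (Finsupp.single x (.single h r)) =
      Finsupp.single (H.subtype ∘ x) (.single (h : G) r) := by
  have h₁ : Representation.free A G (Fin n → G) (h : G)
      (Finsupp.single (H.subtype ∘ x) (.single 1 1)) =
      Finsupp.single (H.subtype ∘ x) (.single (h : G) 1) := by simp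
  have h₂ : r • (Finsupp.single (H.subtype ∘ x) (.single (h : G) 1) :
      (Fin n → G) →₀ MonoidAlgebra A G) =
      Finsupp.single (H.subtype ∘ x) (.single (h : G) r) := by simp
  refine (Representation.freeLift_single_single _ _ _ _ _).trans ?_
  exact (congrArg (r • ·) h₁).trans h₂

/-- The map `(Hⁿ →₀ A[H]) ⟶ (Gⁿ →₀ A[G])` of representations of `H` induced by the inclusion. -/
def barMapF (n : ℕ) :
    Rep.free A H (Fin n → H) ⟶ Rep.res H.subtype (Rep.free A G (Fin n → G)) :=
  Rep.ofHom (freeMap A H n)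

lemma barMapF_single (n : ℕ) (x : Fin n → H) (h : H) (r : A) :
    (barMapF A H n).hom (Finsupp.single x (.single h r)) =
      Finsupp.single (H.subtype ∘ x) (.single (h : G) r) :=
  freeMap_single A H n x h r

/-- The bar differential on generators involves only multiplication in the group, which the
inclusion respects. -/
lemma barMapF_comm (n : ℕ) :
    barMapF A H (n + 1) ≫ (Rep.resFunctor H.subtype).map (Rep.barComplex.d A G n) =
      Rep.barComplex.d A H n ≫ barMapF A H n := by
  refine Rep.free_ext A H _ _ _ fun x => ?_
  change (Rep.barComplex.d A G n).hom ((barMapF A H (n + 1)).hom (Finsupp.single x (.single 1 1))) =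
    (barMapF A H n).hom ((Rep.barComplex.d A H n).hom (Finsupp.single x (.single 1 1)))
  rw [Rep.barComplex.d_single, barMapF_single, map_add, map_sum]
  refine (Rep.barComplex.d_single _ _).trans ?_
  refine congrArg₂ (· + ·) (barMapF_single A H n _ _ _).symm
    (Finset.sum_congr rfl fun j _ => ?_)
  refine Eq.trans ?_ (barMapF_single A H n _ _ _).symm
  rw [Fin.comp_contractNth (· * ·) (· * ·) (map_mul H.subtype)]
  rfl


/-- The chain map from the bar resolution of `H` to the restriction of the bar resolution of `G`. -/
def barMap : Rep.barComplex A H ⟶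
    ((Rep.resFunctor H.subtype).mapHomologicalComplex _).obj (Rep.barComplex A G) where
  f n := barMapF A H n
  comm' i j h := by
    obtain rfl : j + 1 = i := h
    have h₁ := Rep.barComplex.d_def A (G := G) (n := j)
    have h₂ := Rep.barComplex.d_def A (G := H) (n := j)
    rw [h₂]
    exact (congrArg (fun t => barMapF A H (j + 1) ≫ (Rep.resFunctor H.subtype).map t) h₁).trans
      (barMapF_comm A H j)

/-- The vector `y` need not be known: the augmentation takes the value 1 on every basis vector. -/
lemma exists_diagonalSuccIsoFree_inv_single (m : ℕ) (x : Fin m → G) :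
    ∃ y : Fin (m + 1) → G,
      (Rep.diagonalSuccIsoFree A G m).inv.hom (Finsupp.single x (.single 1 1)) =
        MonoidAlgebra.single y 1 := by
  have h₁ : (Rep.leftRegularTensorTrivialIsoFree A G (Fin m → G)).inv.hom
      (Finsupp.single x (.single 1 1)) =
        TensorProduct.tmul A (.single 1 1 : MonoidAlgebra A G) (.single x 1) :=
    Representation.leftRegularTensorTrivialIsoFree_symm_apply_single_single x 1 1
  have h₂ := Representation.linearizeMap_single (k := A)
    (Action.diagonalSuccIsoTensorTrivial G m).inv ((1 : G), x) ((1 : A) * 1)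
  have h₃ := Representation.LinearizeMonoidal.μ_apply_single_single (k := A)
    (X := Action.leftRegular G) (Y := Action.trivial G (Fin m → G)) (1 : G) x 1 1
  have h₄ := (congrArg (fun z => (Representation.linearizeMap
    (Action.diagonalSuccIsoTensorTrivial G m).inv) z) h₃).trans h₂
  rw [mul_one] at h₄
  simp only [Rep.diagonalSuccIsoFree, Rep.diagonalSuccIsoTensorTrivial, Iso.trans_inv,
    Rep.hom_comp, Representation.IntertwiningMap.comp_apply]
  rw [h₁]
  exact ⟨_, h₄⟩

lemma barResolution_π_f_zero_single (x : Fin 0 → G) :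
    ((Rep.barResolution A G).π.f 0).hom (Finsupp.single x (.single 1 1)) = (1 : A) := by
  obtain ⟨y, hy⟩ := exists_diagonalSuccIsoFree_inv_single A 0 x
  have h : (Rep.barResolution A G).π.f 0 =
      (Rep.diagonalSuccIsoFree A G 0).inv ≫ Rep.standardComplex.ε A G :=
    congrArg (_ ≫ ·) (ChainComplex.toSingle₀Equiv_symm_apply_f_zero _ _ :
      (Rep.standardComplex.εToSingle₀ A G).f 0 = _)
  have hε : (Rep.standardComplex.ε A G).hom (.single y 1) = (1 : A) := by
    simp [Rep.standardComplex.ε]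
  rw [h]
  exact (congrArg _ hy).trans hε

/-- Restriction sends the bar resolution of `G` to a projective resolution of the trivial
representation of `H`. As `barMap` is compatible with the two augmentations, which are
quasi-isomorphisms, so is `barMap`. -/
instance quasiIso_barMap : QuasiIso (barMap A H) := by
  let P := (Rep.resFunctor H.subtype).mapProjectiveResolution (Rep.barResolution A G)
  have h : barMap A H ≫ P.π = (Rep.barResolution A H).π := by
    refine HomologicalComplex.to_single_hom_ext ?_
    refine Rep.free_ext A H _ _ _ fun x => ?_
    have h₁ := HomologicalComplex.singleMapHomologicalComplex_hom_app_self
      (Rep.resFunctor (k := A) H.subtype) (ComplexShape.down ℕ) 0 (Rep.trivial A G A)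
    have h₂ : (P.π.f 0).hom = ((Rep.resFunctor H.subtype).map
        ((Rep.barResolution A G).π.f 0)).hom := by
      refine congrArg Rep.Hom.hom ((congrArg (_ ≫ ·) h₁).trans ?_)
      refine (congrArg (_ ≫ ·) (?_ : _ = 𝟙 _)).trans (Category.comp_id _)
      rfl
    refine Eq.trans ?_ (barResolution_π_f_zero_single A x).symm
    refine Eq.trans ?_ (barResolution_π_f_zero_single A (H.subtype ∘ x))
    have h₃ := barMapF_single A H 0 x 1 1
    change (P.π.f 0).hom _ = _
    rw [h₂]
    exact congrArg ((Rep.barResolution A G).π.f 0).hom h₃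
  have : QuasiIso (barMap A H ≫ P.π) := by
    rw [h]
    exact (Rep.barResolution A H).quasiIso
  exact quasiIso_of_comp_right (hφ := P.quasiIso) (hφφ' := this)

/-- A homotopy equivalence survives every additive functor; a mere quasi-isomorphism would not
survive the tensor and Hom functors applied below, which are not exact. -/
lemma homotopyEquivalences_barMap :
    HomologicalComplex.homotopyEquivalences _ _ (barMap A H) := by
  have (n : ℕ) : Projective ((((Rep.resFunctor H.subtype).mapHomologicalComplex _).obj
      (Rep.barComplex A G)).X n) :=
    ((Rep.resFunctor H.subtype).mapProjectiveResolution (Rep.barResolution A G)).projective n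
  have (n : ℕ) : Projective ((Rep.barComplex A H).X n) := (Rep.barResolution A H).projective n
  exact (ChainComplex.quasiIso_iff_of_projective _).1 inferInstance

end BarResolution

/-! ### Shapiro's lemma for group homology and cohomology. -/

section Shapiro

variable {A G : Type u} [CommRing A] [Group G] (H : Subgroup G) (M : Rep.{u} A H)

lemma quasiIso_map_barMap {C : Type u₁} [Category.{v₁} C] [Preadditive C] [CategoryWithHomology C]
    (F : Rep.{u} A H ⥤ C) [F.Additive] :
    QuasiIso ((F.mapHomologicalComplex _).map (barMap A H)) := by
  obtain ⟨e, he⟩ := homotopyEquivalences_barMap A H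
  rw [← he]
  exact (F.mapHomotopyEquiv e).quasiIso_hom

/-- The isomorphism `(M ⊗ Res(P))_H ≅ (Ind(M) ⊗ P)_G`, where `P` is the bar resolution of `G`. -/
def coinvariantsTensorIndBarIso :
    (((Rep.coinvariantsTensor A H).obj M).mapHomologicalComplex _).obj
        (((Rep.resFunctor H.subtype).mapHomologicalComplex _).obj (Rep.barComplex A G)) ≅
      (Rep.barComplex A G).coinvariantsTensorObj (Rep.ind H.subtype M :) :=
  (NatIso.mapHomologicalComplex (Rep.coinvariantsTensorIndNatIso H.subtype M).symm
    (ComplexShape.down ℕ)).app (Rep.barComplex A G)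

/-- The unit of the adjunction between induction and restriction. -/
abbrev indUnit : M ⟶ Rep.res H.subtype (Rep.ind H.subtype M :) :=
  (Rep.indResAdjunction A H.subtype).unit.app M

/-- The map on group homology induced by the inclusion and `M ⟶ Ind M`, as a chain map. -/
abbrev indChainsMap :
    groupHomology.inhomogeneousChains M ⟶
      groupHomology.inhomogeneousChains (Rep.ind H.subtype M :) :=
  groupHomology.chainsMap H.subtype (indUnit H M)

lemma inhomogeneousChainsIso_hom_f_single [DecidableEq G] (N : Rep.{u} A G) (n : ℕ)
    (x : Fin n → G) (a : N) :
    ((groupHomology.inhomogeneousChainsIso N).hom.f n).hom (Finsupp.single x a) =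
      Representation.Coinvariants.mk (N.ρ.tprod (Representation.free A G (Fin n → G)))
        (TensorProduct.tmul A a (Finsupp.single x (.single 1 1))) :=
  Rep.finsuppToCoinvariantsTensorFree_single x a

/-- This identifies the canonical chain map with `barMap` tensored with `M`: both routes send the
chain `x ↦ a` to the class of the unit applied to `a`, tensored with the generator at the image of
`x`. -/
lemma indChainsMap_comp_inhomogeneousChainsIso_hom [DecidableEq G] [DecidableEq H] :
    indChainsMap H M ≫ (groupHomology.inhomogeneousChainsIso (Rep.ind H.subtype M :)).hom =
      (groupHomology.inhomogeneousChainsIso M).hom ≫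
        (((Rep.coinvariantsTensor A H).obj M).mapHomologicalComplex _).map (barMap A H) ≫
        (coinvariantsTensorIndBarIso H M).hom := by
  refine HomologicalComplex.hom_ext _ _ fun n => ?_
  refine groupHomology.inhomogeneousChains.ext fun x => ?_
  refine ModuleCat.hom_ext (LinearMap.ext fun a => ?_)
  have h₁ := groupHomology.chainsMap_f_single H.subtype (indUnit H M) n x a
  have h₂ := inhomogeneousChainsIso_hom_f_single (Rep.ind H.subtype M :) n
    (H.subtype ∘ x) ((indUnit H M).hom a)
  have h₃ := inhomogeneousChainsIso_hom_f_single M n x a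
  have h₄ := barMapF_single A H n x 1 1
  have h₅ := Rep.coinvariantsTensorIndInv_mk_tmul_indMk (A := M) (B := Rep.free A G (Fin n → G))
    H.subtype a (Finsupp.single (H.subtype ∘ x) (.single 1 1))
  change ((groupHomology.inhomogeneousChainsIso (Rep.ind H.subtype M :)).hom.f n).hom
      (((indChainsMap H M).f n).hom (Finsupp.single x a)) =
    (Rep.coinvariantsTensorIndInv H.subtype M (Rep.free A G (Fin n → G))).hom
      ((((Rep.coinvariantsTensor A H).obj M).map (barMapF A H n)).hom
        (((groupHomology.inhomogeneousChainsIso M).hom.f n).hom (Finsupp.single x a)))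
  rw [h₃]
  refine (congrArg _ h₁).trans (h₂.trans ?_)
  refine h₅.symm.trans (congrArg _ ?_)
  exact congrArg (fun t => Representation.Coinvariants.mk _ (TensorProduct.tmul A a t)) h₄.symm

instance quasiIso_indChainsMap : QuasiIso (indChainsMap H M) := by
  classical
  have h := indChainsMap_comp_inhomogeneousChainsIso_hom H M
  have h₁ := quasiIso_map_barMap H ((Rep.coinvariantsTensor A H).obj M)
  have : QuasiIso (indChainsMap H M ≫
      (groupHomology.inhomogeneousChainsIso (Rep.ind H.subtype M :)).hom) := by
    rw [h]
    exact quasiIso_comp _ _ (hφ' := quasiIso_comp _ _)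
  exact quasiIso_of_comp_right _ (groupHomology.inhomogeneousChainsIso (Rep.ind H.subtype M :)).hom

instance isIso_groupHomology_map_unit (n : ℕ) :
    IsIso (groupHomology.map H.subtype ((Rep.indResAdjunction A H.subtype).unit.app M) n) :=
  inferInstanceAs (IsIso (HomologicalComplex.homologyMap (indChainsMap H M) n))

/-- The cochain map `Hom(Res(P), M) ⟶ Hom(Q, M)` given by `barMap`, where `P` and `Q` are the bar
resolutions of `G` and `H`. -/
def linearYonedaObjBarMap :
    ChainComplex.linearYonedaObj (((Rep.resFunctor H.subtype).mapHomologicalComplex _).obj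
        (Rep.barComplex A G)) A M ⟶ (Rep.barComplex A H).linearYonedaObj A M :=
  (HomologicalComplex.unopFunctor (ModuleCat A) _).map
    ((((linearYoneda A (Rep A H)).obj M).rightOp.mapHomologicalComplex _).map (barMap A H)).op

instance quasiIso_linearYonedaObjBarMap : QuasiIso (linearYonedaObjBarMap H M) := by
  have := quasiIso_map_barMap H ((linearYoneda A (Rep A H)).obj M).rightOp
  exact inferInstanceAs (QuasiIso ((HomologicalComplex.unopFunctor (ModuleCat A) _).map
    ((((linearYoneda A (Rep A H)).obj M).rightOp.mapHomologicalComplex _).map (barMap A H)).op))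

/-- The isomorphism `Hom(P, CoInd(M)) ≅ Hom(Res(P), M)`, where `P` is the bar resolution of `G`. -/
def linearYonedaObjCoindBarIso :
    (Rep.barComplex A G).linearYonedaObj A (Rep.coind H.subtype M :) ≅
      ChainComplex.linearYonedaObj (((Rep.resFunctor H.subtype).mapHomologicalComplex _).obj
        (Rep.barComplex A G)) A M :=
  (groupCohomology.linearYonedaObjResProjectiveResolutionIso (Rep.barResolution A G) M).symm

/-- The counit of the adjunction between restriction and coinduction. -/
abbrev coindCounit : Rep.res H.subtype (Rep.coind H.subtype M :) ⟶ M :=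
  (Rep.resCoindAdjunction A H.subtype).counit.app M

/-- The map on group cohomology induced by the inclusion and `CoInd M ⟶ M`, as a cochain map. -/
abbrev coindCochainsMap :
    groupCohomology.inhomogeneousCochains (Rep.coind H.subtype M :) ⟶
      groupCohomology.inhomogeneousCochains M :=
  groupCohomology.cochainsMap H.subtype (coindCounit H M)

lemma inhomogeneousCochainsIso_hom_f_single (N : Rep.{u} A G) (n : ℕ)
    (f : (Fin n → G) → N) (x : Fin n → G) :
    (((groupCohomology.inhomogeneousCochainsIso N).hom.f n).hom f :
        Rep.free A G (Fin n → G) ⟶ N).hom (Finsupp.single x (.single 1 1)) = f x := by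
  refine (Representation.freeLift_single_single N.ρ x 1 1 f).trans ?_
  simp

/-- A cochain is the family of values of a morphism on free generators, and the counit of
coinduction is evaluation at 1, so both routes agree on generators. -/
lemma coindCochainsMap_comp_inhomogeneousCochainsIso_hom :
    coindCochainsMap H M ≫ (groupCohomology.inhomogeneousCochainsIso M).hom =
      (groupCohomology.inhomogeneousCochainsIso (Rep.coind H.subtype M :)).hom ≫
        (linearYonedaObjCoindBarIso H M).hom ≫
        linearYonedaObjBarMap H M := by
  refine HomologicalComplex.hom_ext _ _ fun n => ?_
  refine ModuleCat.hom_ext (LinearMap.ext fun f => ?_)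
  refine Rep.free_ext A H _ _ _ fun x => ?_
  have h₁ := inhomogeneousCochainsIso_hom_f_single M n
    (((coindCochainsMap H M).f n).hom f) x
  have h₂ := inhomogeneousCochainsIso_hom_f_single (Rep.coind H.subtype M :) n f (H.subtype ∘ x)
  have h₃ := barMapF_single A H n x 1 1
  refine h₁.trans ?_
  change _ = Subtype.val ((((groupCohomology.inhomogeneousCochainsIso
    (Rep.coind H.subtype M :)).hom.f n).hom f :
      Rep.free A G (Fin n → G) ⟶ (Rep.coind H.subtype M :)).hom
        ((barMapF A H n).hom (Finsupp.single x (.single 1 1)))) 1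
  rw [h₃]
  refine Eq.trans ?_ (congrArg (fun t : Representation.coindV H.subtype M.ρ => Subtype.val t 1) h₂).symm
  rfl

instance quasiIso_coindCochainsMap : QuasiIso (coindCochainsMap H M) := by
  have h := coindCochainsMap_comp_inhomogeneousCochainsIso_hom H M
  have : QuasiIso (coindCochainsMap H M ≫
      (groupCohomology.inhomogeneousCochainsIso M).hom) := by
    rw [h]
    exact quasiIso_comp _ _ (hφ' := quasiIso_comp _ _)
  exact quasiIso_of_comp_right _ (groupCohomology.inhomogeneousCochainsIso M).hom

instance isIso_groupCohomology_map_counit (n : ℕ) :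
    IsIso (groupCohomology.map H.subtype
      ((Rep.resCoindAdjunction A H.subtype).counit.app M) n) :=
  inferInstanceAs (IsIso (HomologicalComplex.homologyMap (coindCochainsMap H M) n))

variable (A)

/-- Shapiro's lemma for group homology, with the canonical isomorphisms. -/
theorem exists_groupHomologyInt_iso :
    ∃ e : ∀ n : ℤ, Rep.indFunctor A H.subtype ⋙ groupHomologyInt A G n ≅ groupHomologyInt A H n,
      ∀ (n : ℕ) (M : Rep.{u} A H), (e (Int.ofNat n)).inv.app M =
        groupHomology.map H.subtype ((Rep.indResAdjunction A H.subtype).unit.app M) n := by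
  let e (n : ℕ) : groupHomology.functor A H n ≅
      Rep.indFunctor A H.subtype ⋙ groupHomology.functor A G n :=
    NatIso.ofComponents (fun M => @asIso _ _ _ _ _ (isIso_groupHomology_map_unit H M n))
      fun {M N} f => by
        have h := (Rep.indResAdjunction A H.subtype).unit.naturality f
        have h₁ := groupHomology.map_comp (MonoidHom.id H) H.subtype f (indUnit H N) n
        let g : (Rep.ind H.subtype M :) ⟶
            Rep.res (MonoidHom.id G) (Rep.ind H.subtype N :) := (Rep.indFunctor A H.subtype).map f
        have h₂ := groupHomology.map_comp H.subtype (MonoidHom.id G) (indUnit H M) g n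
        -- Both composites are induced by one group homomorphism and one coefficient map, equal by
        -- naturality of the unit.
        refine h₁.symm.trans (Eq.trans ?_ h₂)
        exact groupHomology.map_congr (by rfl)
          (congrArg (fun t => t.hom.toLinearMap) h) n
  exact ⟨fun n => match n with
    | Int.ofNat n => (e n).symm
    -- In negative degrees both functors are definitionally constant at the zero module.
    | Int.negSucc n => Iso.refl _, fun n M => by rfl⟩

/-- Shapiro's lemma for group cohomology, with the canonical isomorphisms. -/
theorem exists_groupCohomologyInt_iso :
    ∃ e : ∀ n : ℤ, Rep.coindFunctor A H.subtype ⋙ groupCohomologyInt A G n ≅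
        groupCohomologyInt A H n,
      ∀ (n : ℕ) (M : Rep.{u} A H), (e (Int.ofNat n)).hom.app M =
        groupCohomology.map H.subtype ((Rep.resCoindAdjunction A H.subtype).counit.app M) n := by
  let e (n : ℕ) : Rep.coindFunctor A H.subtype ⋙ groupCohomology.functor A G n ≅
      groupCohomology.functor A H n :=
    NatIso.ofComponents (fun M => @asIso _ _ _ _ _ (isIso_groupCohomology_map_counit H M n))
      fun {M N} f => by
        have h := (Rep.resCoindAdjunction A H.subtype).counit.naturality f
        let g : Rep.res (MonoidHom.id G) (Rep.coind H.subtype M :) ⟶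
            (Rep.coind H.subtype N :) := (Rep.coindFunctor A H.subtype).map f
        have h₁ := groupCohomology.map_comp (MonoidHom.id G) H.subtype g (coindCounit H N) n
        have h₂ := groupCohomology.map_comp H.subtype (MonoidHom.id H) (coindCounit H M) f n
        refine h₁.symm.trans (Eq.trans ?_ h₂)
        exact groupCohomology.map_congr (by rfl)
          (congrArg (fun t => t.hom.toLinearMap) h) n
  exact ⟨fun n => match n with
    | Int.ofNat n => e n
    | Int.negSucc n => Iso.refl _, fun n M => by rfl⟩

end Shapiro

end

end DerivedShapiro

theorem mainTheorem8 {A G : Type u} [CommRing A] [Group G] (H : Subgroup G)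
    [HasDerivedCategory.{w} (ModuleCat.{u} A)]
    [HasDerivedCategory.{w} (DerivedShapiro.RepCat A G)]
    [HasDerivedCategory.{w} (DerivedShapiro.RepCat A H)] :
    -- homological side: all the derived functors exist, `Bι_!` is its own derived functor, and
    -- `𝐋colim_{BG} ∘ Bι_! ≅ 𝐋colim_{BH}`, compatibly with the underived isomorphism
    (∃ (_ : DerivedShapiro.HasL (DerivedShapiro.colimB A G))
        (_ : DerivedShapiro.HasL (DerivedShapiro.colimB A H))
        (_ : DerivedShapiro.HasL (DerivedShapiro.shriek A H)),
      IsIso (DerivedShapiro.LCounit (DerivedShapiro.shriek A H)) ∧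
      ∃ e : DerivedShapiro.L (DerivedShapiro.shriek A H) ⋙
            DerivedShapiro.L (DerivedShapiro.colimB A G) ≅
          DerivedShapiro.L (DerivedShapiro.colimB A H),
        ∀ K : CochainComplex (DerivedShapiro.RepCat A H) ℤ,
          e.hom.app (DerivedCategory.Q.obj K) ≫
              (DerivedShapiro.LCounit (DerivedShapiro.colimB A H)).app K =
            (DerivedShapiro.L (DerivedShapiro.colimB A G)).map
                ((DerivedShapiro.LCounit (DerivedShapiro.shriek A H)).app K) ≫
              (DerivedShapiro.LCounit (DerivedShapiro.colimB A G)).app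
                (((DerivedShapiro.shriek A H).mapHomologicalComplex
                  (ComplexShape.up ℤ)).obj K) ≫
              DerivedCategory.Q.map (DerivedShapiro.colimComparison A H K)) ∧
    -- cohomological side
    (∃ (_ : DerivedShapiro.HasR (DerivedShapiro.limB A G))
        (_ : DerivedShapiro.HasR (DerivedShapiro.limB A H))
        (_ : DerivedShapiro.HasR (DerivedShapiro.star A H)),
      IsIso (DerivedShapiro.RUnit (DerivedShapiro.star A H)) ∧
      ∃ e : DerivedShapiro.R (DerivedShapiro.star A H) ⋙
            DerivedShapiro.R (DerivedShapiro.limB A G) ≅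
          DerivedShapiro.R (DerivedShapiro.limB A H),
        ∀ K : CochainComplex (DerivedShapiro.RepCat A H) ℤ,
          (DerivedShapiro.RUnit (DerivedShapiro.limB A G)).app
                (((DerivedShapiro.star A H).mapHomologicalComplex
                  (ComplexShape.up ℤ)).obj K) ≫
              (DerivedShapiro.R (DerivedShapiro.limB A G)).map
                ((DerivedShapiro.RUnit (DerivedShapiro.star A H)).app K) ≫
              e.hom.app (DerivedCategory.Q.obj K) =
            DerivedCategory.Q.map (DerivedShapiro.limComparison A H K) ≫
              (DerivedShapiro.RUnit (DerivedShapiro.limB A H)).app K) ∧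
    -- `H_n(G, Ind M) ≅ H_n(H, M)`, whose inverse is induced by `H ⊆ G` and `M ⟶ Ind M`
    (∃ e : ∀ n : ℤ, Rep.indFunctor A H.subtype ⋙ DerivedShapiro.groupHomologyInt A G n ≅
          DerivedShapiro.groupHomologyInt A H n,
        ∀ (n : ℕ) (M : Rep.{u} A H),
          (e (Int.ofNat n)).inv.app M =
            groupHomology.map H.subtype ((Rep.indResAdjunction A H.subtype).unit.app M) n) ∧
    -- `H^n(G, CoInd M) ≅ H^n(H, M)`, induced by `H ⊆ G` and `CoInd M ⟶ M`
    (∃ e : ∀ n : ℤ, Rep.coindFunctor A H.subtype ⋙ DerivedShapiro.groupCohomologyInt A G n ≅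
          DerivedShapiro.groupCohomologyInt A H n,
        ∀ (n : ℕ) (M : Rep.{u} A H),
          (e (Int.ofNat n)).hom.app M =
            groupCohomology.map H.subtype
              ((Rep.resCoindAdjunction A H.subtype).counit.app M) n) :=
  ⟨DerivedShapiro.exists_leftDerived_colim_shriek_iso H,
    DerivedShapiro.exists_rightDerived_lim_star_iso H,
    DerivedShapiro.exists_groupHomologyInt_iso A H,
    DerivedShapiro.exists_groupCohomologyInt_iso A H⟩
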